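/- **Notation.** For an $n$-mode system all matrices are complex and act on doubled-up vectors $(\mathbf a^T,(\mathbf a^{\#})^T)^T$. A matrix is doubled-up if it has the form $\Delta(X,Y)=\begin{pmatrix}X&Y\\Y^{\#}&X^{\#}\end{pmatrix}$, where $^{\#}$ is entrywise complex conjugation. Let $J_n=\mathrm{diag}(\mathbb 1_n,-\mathbb 1_n)$ and, for a $2m\times 2n$ matrix $X$, $X^\flat=J_nX^\dagger J_m$. A doubled-up $T$ is symplectic if $T^\flat T=TT^\flat=\mathbb 1$. A quantum linear system (QLS) with $m$ channels and $n\ge 0$ modes is a triple $(S,C,\Omega)$ with $S$ symplectic ($2m\times2m$), $C$ doubled-up ($2m\times 2n$) and $\Omega$ doubled-up and Hermitian ($2n\times2n$); $(C,\Omega)$ stands for $(\mathbb 1,C,\Omega)$, and SISO means $m=1$. Put $A=-\tfrac12C^\flat C-iJ_n\Omega$ and $\Xi(s)=\bigl(\mathbb 1-C(s\mathbb 1-A)^{-1}C^\flat\bigr)S$. The system is Hurwitz stable if all eigenvalues of $A$ have negative real part. For an input covariance $V=V(N,M)=\begin{pmatrix}N^T+\mathbb 1&M\\M^\dagger&N\end{pmatrix}$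 with $N=N^\dagger$, $M=M^T$, the power spectrum is $\Psi_V(s)=\Xi(s)V\,\Xi(-s^{\#})^\dagger$. For stable systems $\Xi$ and $\Psi_V$ are determined by, and identified with, their values on the imaginary axis $s=-i\omega$, $\omega\in\mathbb R$. The input is pure if $S_{\rm in}VS_{\rm in}^\dagger=V(0,0)$ for some symplectic $S_{\rm in}$. A stable QLS is globally minimal for $V$ if no stable QLS with fewer modes has the same power spectrum. **Corollary (indirect globally minimal realisation).** Let $V=V(N,M)$ be a pure input covariance for one channel. There is a map $\Psi\mapsto\Xi'_\Psi$ from power spectra to transfer functions such that, for every Hurwitz stable SISO QLS $(C,\Omega)$ with input $V$ and power spectrum $\Psi$, the following hold. 1. $\Xi'=\Xi'_\Psi$ is the transfer function of some globally minimal stable SISO QLS $(C',\Omega')$ with power spectrum $\Psi$ (a *globally minimal realisation* of $\Psi$). 2. $\Xi'$ has a minimal (observable and controllable) classical realisation $\Xi'(s)=\mathbb 1+C_0(s\mathbb 1-A_0)^{-1}B_0$ with doubled-up $A_0,B_0,C_0$. For every such realisation, with $2k\times2k$ matrix $A_0$, there is an invertible doubled-up $T$ with $$(T^\dagger J_kT)A_0+A_0^\dagger(T^\dagger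 J_kT)+C_0^\dagger J_1C_0=0,$$ and for every such $T$ the pair $$C'=C_0T^{-1},\qquad \Omega'=iJ_k\bigl(TA_0T^{-1}+\tfrac12C'^\flat C'\bigr)$$ is a SISO QLS with transfer function $\Xi'$ and is a globally minimal realisation of $\Psi$. 3. The globally minimal realisation is unique up to symplectic equivalence: if $(C_1,\Omega_1)$, with $k$ modes, is a globally minimal realisation of $\Psi$, then its transfer function is $\Xi'$, and a SISO QLS $(S_2,C_2,\Omega_2)$ with $l$ modes is a globally minimal realisation of $\Psi$ (in particular $S_2=\mathbb 1$) if and only if $S_2=\mathbb 1$, $l=k$ and there is a symplectic matrix $T$ with $J_k\Omega_2=TJ_k\Omega_1T^\flat$ and $C_2=C_1T^\flat$. -/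

import Mathlib

open scoped Matrix

noncomputable section

namespace QLin

/-- Index set of the doubled-up vectors `(a₁, …, aₙ, a₁^#, …, aₙ^#)`. -/
abbrev Doubled (n : ℕ) : Type := Fin n ⊕ Fin n

/-- Entrywise complex conjugation `X^#`. -/
def conjEntries {a b : Type*} (X : Matrix a b ℂ) : Matrix a b ℂ := X.map (starRingEnd ℂ)

/-- The doubled-up matrix `Δ(X, Y) = [X, Y; Y^#, X^#]`. -/
def Delta {a b : ℕ} (X Y : Matrix (Fin a) (Fin b) ℂ) : Matrix (Doubled a) (Doubled b) ℂ :=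
  Matrix.fromBlocks X Y (conjEntries Y) (conjEntries X)

def IsDoubledUp {a b : ℕ} (Z : Matrix (Doubled a) (Doubled b) ℂ) : Prop :=
  ∃ X Y : Matrix (Fin a) (Fin b) ℂ, Z = Delta X Y

/-- `Jₙ = diag(1ₙ, -1ₙ)`. -/
def J (n : ℕ) : Matrix (Doubled n) (Doubled n) ℂ := Matrix.fromBlocks 1 0 0 (-1)

/-- `X^♭ = J X† J`. -/
def flat {a b : ℕ} (X : Matrix (Doubled a) (Doubled b) ℂ) : Matrix (Doubled b) (Doubled a) ℂ :=
  J b * Xᴴ * J a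

/-- Symplectic matrices: `♭`-unitary and doubled-up. The two index sets are allowed to be
syntactically different; the two equations force `a = b`. -/
def IsSymplectic {a b : ℕ} (T : Matrix (Doubled a) (Doubled b) ℂ) : Prop :=
  IsDoubledUp T ∧ flat T * T = 1 ∧ T * flat T = 1

/-- Input covariance `V(N, M) = [Nᵀ + 1, M; M†, N]`. -/
def inputCovariance {m : ℕ} (N M : Matrix (Fin m) (Fin m) ℂ) :
    Matrix (Doubled m) (Doubled m) ℂ :=
  Matrix.fromBlocks (Nᵀ + 1) M Mᴴ N

/-- `V(N, M)` is the covariance of a pure Gaussian state: a symplectic change of the field modes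
turns it into the vacuum covariance `V(0, 0)` (so in particular `V(N, M) ≥ 0`; for one channel
this says `N ≥ 0` and `|M|² = N (N + 1)`). -/
def IsPureInput {m : ℕ} (N M : Matrix (Fin m) (Fin m) ℂ) : Prop :=
  N.IsHermitian ∧ M.IsSymm ∧
    ∃ T : Matrix (Doubled m) (Doubled m) ℂ, IsSymplectic T ∧
      T * inputCovariance N M * Tᴴ = inputCovariance 0 0

/-- All eigenvalues have strictly negative real part. -/
def IsHurwitzMatrix {n : ℕ} (A : Matrix (Doubled n) (Doubled n) ℂ) : Prop :=
  ∀ z ∈ spectrum ℂ A, z.re < 0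

/-- A quantum linear system with `m` channels and `n` modes, given by its scattering/squeezing
matrix, coupling matrix `C = Δ(C₋, C₊)` and hamiltonian matrix `Ω = Δ(Ω₋, Ω₊)`. That `Ω` is
Hermitian says `Ω₋ = Ω₋†` and `Ω₊ = Ω₊ᵀ`. -/
structure System (m n : ℕ) where
  S : Matrix (Doubled m) (Doubled m) ℂ
  C : Matrix (Doubled m) (Doubled n) ℂ
  Ω : Matrix (Doubled n) (Doubled n) ℂ
  symplectic_S : IsSymplectic S
  doubledUp_C : IsDoubledUp C
  doubledUp_Ω : IsDoubledUp Ω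
  hermitian_Ω : Ω.IsHermitian

namespace System

variable {m n : ℕ}

/-- `A = -½ C^♭ C - i Jₙ Ω`. -/
def A (G : System m n) : Matrix (Doubled n) (Doubled n) ℂ :=
  -((1 / 2 : ℂ) • (flat G.C * G.C)) - Complex.I • (J n * G.Ω)

def IsHurwitz (G : System m n) : Prop := IsHurwitzMatrix G.A

/-- `Ξ(s) = (1 - C (s - A)⁻¹ C^♭) S`. -/
def transfer (G : System m n) (s : ℂ) : Matrix (Doubled m) (Doubled m) ℂ :=
  (1 - G.C * (s • (1 : Matrix (Doubled n) (Doubled n) ℂ) - G.A)⁻¹ * flat G.C) * G.S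

/-- `Ψ_V(s) = Ξ(s) V Ξ(-s^#)†`. -/
def spectralDensity (G : System m n) (V : Matrix (Doubled m) (Doubled m) ℂ) (s : ℂ) :
    Matrix (Doubled m) (Doubled m) ℂ :=
  G.transfer s * V * (G.transfer (-(starRingEnd ℂ s)))ᴴ

/-- The transfer function in the frequency domain, `ω ↦ Ξ(-iω)`. A Hurwitz system has no pole on
the imaginary axis, and the rational function `Ξ` is determined by its values there. -/
def freqTransfer (G : System m n) : ℝ → Matrix (Doubled m) (Doubled m) ℂ :=
  fun ω => G.transfer (-(Complex.I * ω))

/-- The power spectrum in the frequency domain, `ω ↦ Ψ_V(-iω) = Ξ(-iω) V Ξ(-iω)†`. As for the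
transfer function, it determines the rational function `Ψ_V` of a Hurwitz system. -/
def powerSpectrum (G : System m n) (V : Matrix (Doubled m) (Doubled m) ℂ) :
    ℝ → Matrix (Doubled m) (Doubled m) ℂ :=
  fun ω => G.spectralDensity V (-(Complex.I * ω))

/-- No (stable) system with fewer modes has the same power spectrum. -/
def IsGloballyMinimal (G : System m n) (V : Matrix (Doubled m) (Doubled m) ℂ) : Prop :=
  G.IsHurwitz ∧ ∀ (k : ℕ) (K : System m k), K.IsHurwitz →
    K.powerSpectrum V = G.powerSpectrum V → n ≤ k

/-- `G = (1, C, Ω)` is a globally minimal realisation of the power spectrum `Ψ` for input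
covariance `V`. -/
def IsGloballyMinimalRealisation (G : System m n) (V : Matrix (Doubled m) (Doubled m) ℂ)
    (Ψ : ℝ → Matrix (Doubled m) (Doubled m) ℂ) : Prop :=
  G.S = 1 ∧ G.powerSpectrum V = Ψ ∧ G.IsGloballyMinimal V

/-- Symplectic equivalence: `J Ω' = T J Ω T^♭`, `C' = C T^♭`, `S = S'` for a symplectic `T`. -/
def SymplecticEquiv {n' : ℕ} (G : System m n) (G' : System m n') : Prop :=
  G.S = G'.S ∧ ∃ T : Matrix (Doubled n') (Doubled n) ℂ, IsSymplectic T ∧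
    J n' * G'.Ω = T * (J n * G.Ω) * flat T ∧ G'.C = G.C * flat T

end System

/-- `(A₀, B₀, C₀)` is a minimal (observable and controllable) classical linear system, with doubled-up
matrices and not necessarily physical, whose transfer function `1 + C₀ (s - A₀)⁻¹ B₀` is
`Ξ` on the imaginary axis `s = -iω`, away from the eigenvalues of `A₀`. -/
structure IsMinimalClassicalRealisation {m k : ℕ}
    (A₀ : Matrix (Doubled k) (Doubled k) ℂ) (B₀ : Matrix (Doubled k) (Doubled m) ℂ)
    (C₀ : Matrix (Doubled m) (Doubled k) ℂ) (Ξ : ℝ → Matrix (Doubled m) (Doubled m) ℂ) :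
    Prop where
  doubledUp_A : IsDoubledUp A₀
  doubledUp_B : IsDoubledUp B₀
  doubledUp_C : IsDoubledUp C₀
  observable : ∀ x : Doubled k → ℂ, (∀ j : ℕ, (C₀ * A₀ ^ j) *ᵥ x = 0) → x = 0
  controllable : ∀ x : Doubled k → ℂ, (∀ j : ℕ, x ᵥ* (A₀ ^ j * B₀) = 0) → x = 0
  transfer_eq : ∀ ω : ℝ, -(Complex.I * ω) ∉ spectrum ℂ A₀ →
    Ξ ω = 1 + C₀ * ((-(Complex.I * ω)) • (1 : Matrix (Doubled k) (Doubled k) ℂ) - A₀)⁻¹ * B₀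

/-- `T` is an invertible doubled-up solution of
`(T† J T) A₀ + A₀† (T† J T) + C₀† J C₀ = 0`. -/
def IsPhysicalTransformation {m k : ℕ} (A₀ : Matrix (Doubled k) (Doubled k) ℂ)
    (C₀ : Matrix (Doubled m) (Doubled k) ℂ) (T : Matrix (Doubled k) (Doubled k) ℂ) : Prop :=
  IsDoubledUp T ∧ IsUnit T ∧
    (Tᴴ * J k * T) * A₀ + A₀ᴴ * (Tᴴ * J k * T) + C₀ᴴ * J m * C₀ = 0

end QLin

end

/-!
For every system `J` solves the Lyapunov equation `J A + A† J + C† J C = 0`. If `A` is Hurwitz and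
`C x = 0` for an eigenvector `A x = z x`, then `J x` is an eigenvector of `A†` for `-z`, which is
impossible; so a Hurwitz system is observable and controllable. Transfer functions then determine
systems up to similarity, and the similarity is symplectic since the Lyapunov equation has only one
solution.

A pure one-channel input covariance has rank one, `V = v v†` with `v† J v = 1`, so that
`Ψ(-iω) = w w†` with `w = Ξ(-iω) v`. Global minimality forces `Ξ(s) v` to be zero-free on the closed
right half-plane: the mode excited at a zero `z` can be split off, which multiplies `Ξ(s) v` by
`(s + z̄) / (s - z)`, of modulus one on the imaginary axis. Two zero-free factors of the same
rank-one spectrum are proportional on the axis; their ratio and its inverse are bounded by one on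
the half-plane by the maximum principle and tend to one at infinity, so the factors agree. Since `Ξ`
is doubled-up, `Ξ(s) v` for all `s` determines `Ξ(s) v^#` and hence `Ξ`.
-/

noncomputable section

namespace QLin

section Conjugation

variable {α β γ : Type*}

/-- The conjugation `(x₁, x₂) ↦ (x₂^#, x₁^#)` of doubled-up vectors. -/
def conjVec : (α ⊕ α → ℂ) →ₗ⋆[ℂ] (α ⊕ α → ℂ) where
  toFun x i := star (x i.swap)
  map_add' _ _ := by ext; simp
  map_smul' _ _ := by ext; simp

/-- The conjugation `Z ↦ Σ Z^# Σ`, with `Σ` the swap of the two halves, induced by `conjVec` on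
matrices. Its fixed points are the doubled-up matrices. -/
def conjMat : Matrix (α ⊕ α) (β ⊕ β) ℂ →ₗ⋆[ℂ] Matrix (α ⊕ α) (β ⊕ β) ℂ where
  toFun Z := Zᴴᵀ.submatrix Sum.swap Sum.swap
  map_add' _ _ := by ext; simp
  map_smul' _ _ := by ext; simp

@[simp] lemma conjVec_apply (x : α ⊕ α → ℂ) (i : α ⊕ α) : conjVec x i = star (x i.swap) := rfl

@[simp] lemma conjMat_apply (Z : Matrix (α ⊕ α) (β ⊕ β) ℂ) (i : α ⊕ α) (j : β ⊕ β) :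
    conjMat Z i j = star (Z i.swap j.swap) := rfl

@[simp] lemma conjVec_conjVec (x : α ⊕ α → ℂ) : conjVec (conjVec x) = x := by
  ext; simp

lemma conjMat_conjTranspose (Z : Matrix (α ⊕ α) (β ⊕ β) ℂ) : conjMat Zᴴ = (conjMat Z)ᴴ := rfl

@[simp] lemma conjMat_one [DecidableEq α] : conjMat (1 : Matrix (α ⊕ α) (α ⊕ α) ℂ) = 1 := by
  ext (i | i) (j | j) <;> simp [Matrix.one_apply]

lemma conjMat_mul [Fintype β] (Y : Matrix (α ⊕ α) (β ⊕ β) ℂ) (Z : Matrix (β ⊕ β) (γ ⊕ γ) ℂ) :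
    conjMat (Y * Z) = conjMat Y * conjMat Z := by
  ext i j
  simp only [conjMat_apply, Matrix.mul_apply, star_sum, star_add, star_mul', Fintype.sum_sum_type,
    Sum.swap_inl, Sum.swap_inr]
  exact add_comm _ _

lemma conjVec_mulVec [Fintype β] (Y : Matrix (α ⊕ α) (β ⊕ β) ℂ) (x : β ⊕ β → ℂ) :
    conjVec (Y *ᵥ x) = conjMat Y *ᵥ conjVec x := by
  ext i
  simp only [conjVec_apply, conjMat_apply, Matrix.mulVec, dotProduct, star_sum, star_add, star_mul',
    Fintype.sum_sum_type, Sum.swap_inl, Sum.swap_inr]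
  exact add_comm _ _

lemma conjMat_pow [Fintype α] [DecidableEq α] (Z : Matrix (α ⊕ α) (α ⊕ α) ℂ) (j : ℕ) :
    conjMat (Z ^ j) = conjMat Z ^ j := by
  induction j with
  | zero => simp
  | succ j ih => rw [pow_succ, pow_succ, conjMat_mul, ih]

lemma conjMat_inv [Fintype α] [DecidableEq α] (Z : Matrix (α ⊕ α) (α ⊕ α) ℂ) :
    conjMat Z⁻¹ = (conjMat Z)⁻¹ := by
  change Z⁻¹ᴴᵀ.submatrix (Equiv.sumComm α α) (Equiv.sumComm α α) =
    (Zᴴᵀ.submatrix (Equiv.sumComm α α) (Equiv.sumComm α α))⁻¹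
  rw [Matrix.inv_submatrix_equiv, Matrix.conjTranspose_nonsing_inv, Matrix.transpose_nonsing_inv]

end Conjugation

lemma isDoubledUp_iff {a b : ℕ} {Z : Matrix (Doubled a) (Doubled b) ℂ} :
    IsDoubledUp Z ↔ conjMat Z = Z := by
  constructor
  · rintro ⟨X, Y, rfl⟩
    ext (i | i) (j | j) <;> simp [Delta, conjEntries]
  · intro h
    refine ⟨Z.toBlocks₁₁, Z.toBlocks₁₂, ?_⟩
    ext (i | i) (j | j)
    · rfl
    · rfl
    · exact (congrFun₂ h (.inr i) (.inl j)).symm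
    · exact (congrFun₂ h (.inr i) (.inr j)).symm

section Flat

variable {a b c : ℕ}

@[simp] lemma J_mul_J (n : ℕ) : J n * J n = 1 := by
  simp [J, Matrix.fromBlocks_multiply]

@[simp] lemma conjTranspose_J (n : ℕ) : (J n)ᴴ = J n := by
  simp [J, Matrix.fromBlocks_conjTranspose]

@[simp] lemma conjMat_J (n : ℕ) : conjMat (J n) = -J n := by
  ext (i | i) (j | j) <;> simp [J, Matrix.one_apply]

lemma J_mul_cancel (X : Matrix (Doubled a) (Doubled b) ℂ) : J a * (J a * X) = X := by
  rw [← Matrix.mul_assoc, J_mul_J, Matrix.one_mul]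

lemma mul_J_cancel (X : Matrix (Doubled a) (Doubled b) ℂ) : X * J b * J b = X := by
  rw [Matrix.mul_assoc, J_mul_J, Matrix.mul_one]

@[simp] lemma flat_flat (X : Matrix (Doubled a) (Doubled b) ℂ) : flat (flat X) = X := by
  simp only [flat, Matrix.conjTranspose_mul, Matrix.conjTranspose_conjTranspose, conjTranspose_J]
  rw [J_mul_cancel, mul_J_cancel]

lemma flat_mul (X : Matrix (Doubled a) (Doubled b) ℂ) (Y : Matrix (Doubled b) (Doubled c) ℂ) :
    flat (X * Y) = flat Y * flat X := by
  simp only [flat, Matrix.conjTranspose_mul, Matrix.mul_assoc, J_mul_cancel]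

lemma flat_sub (X Y : Matrix (Doubled a) (Doubled b) ℂ) : flat (X - Y) = flat X - flat Y := by
  simp only [flat, Matrix.conjTranspose_sub, Matrix.mul_sub, Matrix.sub_mul]

lemma flat_smul (z : ℂ) (X : Matrix (Doubled a) (Doubled b) ℂ) :
    flat (z • X) = star z • flat X := by
  simp only [flat, Matrix.conjTranspose_smul, Matrix.mul_smul, Matrix.smul_mul]

@[simp] lemma flat_one : flat (1 : Matrix (Doubled a) (Doubled a) ℂ) = 1 := by
  simp [flat]

@[simp] lemma flat_J : flat (J a) = J a := by
  simp [flat]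

lemma conjMat_flat (X : Matrix (Doubled a) (Doubled b) ℂ) :
    conjMat (flat X) = flat (conjMat X) := by
  simp [flat, conjMat_mul, conjMat_conjTranspose]

lemma IsDoubledUp.flat {X : Matrix (Doubled a) (Doubled b) ℂ} (h : IsDoubledUp X) :
    IsDoubledUp (flat X) := by
  rw [isDoubledUp_iff, conjMat_flat, isDoubledUp_iff.1 h]

lemma IsDoubledUp.mul {X : Matrix (Doubled a) (Doubled b) ℂ}
    {Y : Matrix (Doubled b) (Doubled c) ℂ} (hX : IsDoubledUp X) (hY : IsDoubledUp Y) :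
    IsDoubledUp (X * Y) := by
  rw [isDoubledUp_iff, conjMat_mul, isDoubledUp_iff.1 hX, isDoubledUp_iff.1 hY]

lemma IsDoubledUp.inv {X : Matrix (Doubled a) (Doubled a) ℂ} (hX : IsDoubledUp X) :
    IsDoubledUp X⁻¹ := by
  rw [isDoubledUp_iff, conjMat_inv, isDoubledUp_iff.1 hX]

lemma isDoubledUp_one : IsDoubledUp (1 : Matrix (Doubled a) (Doubled a) ℂ) := by
  rw [isDoubledUp_iff, conjMat_one]

end Flat

section Symplectic

variable {a b : ℕ}

lemma isSymplectic_one : IsSymplectic (1 : Matrix (Doubled a) (Doubled a) ℂ) :=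
  ⟨isDoubledUp_one, by rw [flat_one, Matrix.one_mul], by rw [flat_one, Matrix.one_mul]⟩

lemma IsSymplectic.flat {T : Matrix (Doubled a) (Doubled b) ℂ} (hT : IsSymplectic T) :
    IsSymplectic (flat T) :=
  ⟨hT.1.flat, by rw [flat_flat, hT.2.2], by rw [flat_flat, hT.2.1]⟩

lemma isSymplectic_of_flat_mul_self {T : Matrix (Doubled a) (Doubled b) ℂ}
    {T' : Matrix (Doubled b) (Doubled a) ℂ} (hT : IsDoubledUp T) (h : flat T * T = 1)
    (h' : T * T' = 1) : IsSymplectic T := by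
  have hT' : flat T = T' := by
    rw [← Matrix.mul_one (flat T), ← h', ← Matrix.mul_assoc, h, Matrix.one_mul]
  exact ⟨hT, h, hT' ▸ h'⟩

end Symplectic

section JForm

variable {a b n : ℕ}

/-- The indefinite inner product `x† J y` on doubled-up vectors, conjugate-linear in `x`. -/
def jForm : (Doubled n → ℂ) →ₗ⋆[ℂ] (Doubled n → ℂ) →ₗ[ℂ] ℂ :=
  LinearMap.mk₂'ₛₗ (starRingEnd ℂ) (RingHom.id ℂ) (fun x y => star x ⬝ᵥ (J n *ᵥ y))
    (by simp [add_dotProduct]) (by simp) (by simp [Matrix.mulVec_add])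
    (by simp [Matrix.mulVec_smul])

lemma jForm_eq_dotProduct (x y : Doubled n → ℂ) : jForm x y = star x ⬝ᵥ (J n *ᵥ y) := rfl

lemma jForm_apply (x y : Doubled n → ℂ) :
    jForm x y =
      (∑ i, star (x (.inl i)) * y (.inl i)) - ∑ i, star (x (.inr i)) * y (.inr i) := by
  simp [jForm_eq_dotProduct, J, dotProduct, Matrix.fromBlocks_mulVec, Fintype.sum_sum_type,
    Matrix.neg_mulVec, sub_eq_add_neg]

lemma star_jForm (x y : Doubled n → ℂ) : star (jForm x y) = jForm y x := by
  simp [jForm_apply, mul_comm]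

lemma ofReal_re_jForm_self (x : Doubled n → ℂ) : ((jForm x x).re : ℂ) = jForm x x :=
  Complex.conj_eq_iff_re.1 (star_jForm x x)

@[simp] lemma jForm_conjVec_self (x : Doubled n → ℂ) : jForm x (conjVec x) = 0 := by
  simp [jForm_apply, mul_comm]

lemma jForm_conjVec_conjVec (x y : Doubled n → ℂ) :
    jForm (conjVec x) (conjVec y) = -jForm y x := by
  simp [jForm_apply, mul_comm]

lemma jForm_conjVec_left (x y : Doubled n → ℂ) : jForm (conjVec x) y = -jForm (conjVec y) x := by
  rw [← jForm_conjVec_conjVec, conjVec_conjVec]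

lemma jForm_mulVec_right (Z : Matrix (Doubled a) (Doubled b) ℂ) (x : Doubled a → ℂ)
    (y : Doubled b → ℂ) : jForm x (Z *ᵥ y) = jForm (flat Z *ᵥ x) y := by
  simp only [jForm_eq_dotProduct, flat, Matrix.mulVec_mulVec, Matrix.star_mulVec,
    Matrix.conjTranspose_mul, Matrix.conjTranspose_conjTranspose, conjTranspose_J,
    Matrix.dotProduct_mulVec, Matrix.vecMul_vecMul]
  rw [← Matrix.mul_assoc, mul_J_cancel]

lemma jForm_mulVec_left (Z : Matrix (Doubled a) (Doubled b) ℂ) (x : Doubled a → ℂ)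
    (y : Doubled b → ℂ) : jForm (Z *ᵥ y) x = jForm y (flat Z *ᵥ x) := by
  rw [jForm_mulVec_right, flat_flat]

lemma flat_mulVec_apply (X : Matrix (Doubled a) (Doubled b) ℂ) (y : Doubled a → ℂ)
    (i : Doubled b) : (flat X *ᵥ y) i = J b i i * jForm (fun k => X k i) y := by
  have hJ : ∀ z : Doubled b → ℂ, (J b *ᵥ z) i = J b i i * z i := by
    intro z
    rcases i with i | i <;> simp [J, Matrix.fromBlocks_mulVec, Matrix.neg_mulVec]
  rw [flat, ← Matrix.mulVec_mulVec, ← Matrix.mulVec_mulVec, hJ]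
  rfl

lemma eq_zero_of_forall_jForm_eq_zero {y : Doubled n → ℂ} (h : ∀ x, jForm x y = 0) : y = 0 := by
  have hJy : J n *ᵥ y = 0 := by
    refine dotProduct_eq_zero _ fun x => ?_
    rw [dotProduct_comm, ← star_star x]
    exact h (star x)
  rw [← Matrix.one_mulVec y, ← J_mul_J, ← Matrix.mulVec_mulVec, hJy, Matrix.mulVec_zero]

end JForm

section SymplecticFrame

variable {n d : ℕ}

/-- The doubled-up matrix whose columns are the vectors of a family followed by their conjugates. -/
def doubledCols (p : Fin d → Doubled n → ℂ) : Matrix (Doubled n) (Doubled d) ℂ :=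
  Matrix.of fun i j => Sum.elim p (fun k => conjVec (p k)) j i

lemma isDoubledUp_doubledCols (p : Fin d → Doubled n → ℂ) : IsDoubledUp (doubledCols p) := by
  rw [isDoubledUp_iff]
  ext i (j | j) <;> simp [doubledCols]

lemma mul_doubledCols {m : ℕ} {Z : Matrix (Doubled m) (Doubled n) ℂ} (hZ : IsDoubledUp Z)
    (p : Fin d → Doubled n → ℂ) : Z * doubledCols p = doubledCols fun k => Z *ᵥ p k := by
  ext i (j | j)
  · rfl
  · change (Z *ᵥ conjVec (p j)) i = conjVec (Z *ᵥ p j) i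
    rw [conjVec_mulVec, isDoubledUp_iff.1 hZ]

lemma doubledCols_mulVec (p : Fin d → Doubled n → ℂ) (y : Doubled d → ℂ) :
    doubledCols p *ᵥ y = ∑ k, (y (.inl k) • p k + y (.inr k) • conjVec (p k)) := by
  ext i
  simp [doubledCols, Matrix.mulVec, dotProduct, Fintype.sum_sum_type, Finset.sum_add_distrib,
    mul_comm]

lemma flat_doubledCols_mulVec_inl (p : Fin d → Doubled n → ℂ) (y : Doubled n → ℂ) (k : Fin d) :
    (flat (doubledCols p) *ᵥ y) (.inl k) = jForm (p k) y := by
  rw [flat_mulVec_apply]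
  simp [J, doubledCols]

lemma flat_doubledCols_mulVec_inr (p : Fin d → Doubled n → ℂ) (y : Doubled n → ℂ) (k : Fin d) :
    (flat (doubledCols p) *ᵥ y) (.inr k) = jForm (conjVec y) (p k) := by
  rw [flat_mulVec_apply, jForm_conjVec_left y]
  simp only [J, doubledCols, Matrix.fromBlocks_apply₂₂, Matrix.neg_apply, Matrix.one_apply_eq,
    Matrix.of_apply, Sum.elim_inr, neg_mul, one_mul]

lemma doubledCols_mul_flat_mulVec (p : Fin d → Doubled n → ℂ) (y : Doubled n → ℂ) :
    (doubledCols p * flat (doubledCols p)) *ᵥ y =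
      ∑ k, (jForm (p k) y • p k + jForm (conjVec y) (p k) • conjVec (p k)) := by
  simp only [← Matrix.mulVec_mulVec, doubledCols_mulVec, flat_doubledCols_mulVec_inl,
    flat_doubledCols_mulVec_inr]

/-- A family of vectors which together with its conjugates is a symplectic frame of its span. -/
structure SymplecticFamily (p : Fin d → Doubled n → ℂ) : Prop where
  jForm_eq : ∀ i j, jForm (p i) (p j) = if i = j then 1 else 0
  jForm_conjVec_eq : ∀ i j, jForm (p i) (conjVec (p j)) = 0

lemma SymplecticFamily.flat_mul_self {p : Fin d → Doubled n → ℂ} (hp : SymplecticFamily p) :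
    flat (doubledCols p) * doubledCols p = 1 := by
  ext i j
  change (flat (doubledCols p) *ᵥ (doubledCols p).col j) i = _
  have hcol : (doubledCols p).col j = Sum.elim p (fun k => conjVec (p k)) j := rfl
  rcases i with i | i
  · rw [flat_doubledCols_mulVec_inl, hcol]
    rcases j with j | j <;> simp [hp.jForm_eq, hp.jForm_conjVec_eq, Matrix.one_apply]
  · rw [flat_doubledCols_mulVec_inr, hcol, ← star_jForm]
    rcases j with j | j <;>
      simp [hp.jForm_eq, hp.jForm_conjVec_eq, Matrix.one_apply, apply_ite]

lemma SymplecticFamily.snoc {p : Fin d → Doubled n → ℂ} (hp : SymplecticFamily p)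
    {w : Doubled n → ℂ} (hw : jForm w w = 1) (hflat : flat (doubledCols p) *ᵥ w = 0) :
    SymplecticFamily (Fin.snoc p w : Fin (d + 1) → Doubled n → ℂ) := by
  have hpw (k) : jForm (p k) w = 0 := by rw [← flat_doubledCols_mulVec_inl, hflat]; rfl
  have hwp (k) : jForm w (p k) = 0 := by rw [← star_jForm, hpw, star_zero]
  have hpw' (k) : jForm (p k) (conjVec w) = 0 := by
    rw [← star_jForm, ← flat_doubledCols_mulVec_inr, hflat, Pi.zero_apply, star_zero]
  have hwp' (k) : jForm w (conjVec (p k)) = 0 := by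
    rw [← conjVec_conjVec w, jForm_conjVec_conjVec, hpw', neg_zero]
  constructor
  · intro i j
    refine Fin.lastCases ?_ (fun i => ?_) i <;> refine Fin.lastCases ?_ (fun j => ?_) j
    · simp [hw]
    · simp [hwp, (Fin.castSucc_lt_last j).ne']
    · simp [hpw, (Fin.castSucc_lt_last i).ne]
    · simp [hp.jForm_eq]
  · intro i j
    refine Fin.lastCases ?_ (fun i => ?_) i <;> refine Fin.lastCases ?_ (fun j => ?_) j <;>
      simp [hwp', hpw', hp.jForm_conjVec_eq]

lemma le_of_mul_eq_one_of_doubled {L : Matrix (Doubled d) (Doubled n) ℂ}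
    {P : Matrix (Doubled n) (Doubled d) ℂ} (h : L * P = 1) : d ≤ n := by
  have hinj : Function.Injective P.mulVec :=
    Function.LeftInverse.injective (g := L.mulVec) fun x => by
      rw [Matrix.mulVec_mulVec, h, Matrix.one_mulVec]
  have := LinearMap.finrank_le_finrank_of_injective (f := P.mulVecLin) hinj
  simp only [Module.finrank_fintype_fun_eq_card, Fintype.card_sum, Fintype.card_fin] at this
  omega

lemma sesqForm_eq_zero_of_forall_self {E : Type*} [AddCommGroup E] [Module ℂ E]
    {B : E →ₗ⋆[ℂ] E →ₗ[ℂ] ℂ} (h : ∀ x, B x x = 0) : B = 0 := by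
  ext x y
  have hadd := h (x + y)
  have hadd_I := h (x + Complex.I • y)
  simp only [map_add, LinearMap.add_apply, h, map_smulₛₗ, LinearMap.smul_apply, Complex.conj_I,
    RingHom.id_apply, smul_eq_mul] at hadd hadd_I
  have hI : Complex.I * (B x y - B y x) = 0 := by linear_combination hadd_I
  have hsymm : B x y - B y x = 0 := by simpa using hI
  simp only [LinearMap.zero_apply]
  linear_combination (1 / 2) * hadd + (1 / 2) * hsymm

lemma exists_jForm_smul_self_eq_one {w : Doubled n → ℂ} (hw : 0 < (jForm w w).re) :
    ∃ c : ℂ, jForm (c • w) (c • w) = 1 := by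
  have hsq : (√(jForm w w).re : ℂ) * √(jForm w w).re = jForm w w := by
    rw [← Complex.ofReal_mul, Real.mul_self_sqrt hw.le, ofReal_re_jForm_self]
  have hne : jForm w w ≠ 0 := fun h => by simp [h] at hw
  refine ⟨(√(jForm w w).re : ℂ)⁻¹, ?_⟩
  simp only [map_smulₛₗ, LinearMap.smul_apply, map_inv₀, Complex.conj_ofReal, RingHom.id_apply,
    smul_eq_mul]
  rw [← mul_assoc, ← mul_inv, hsq, inv_mul_cancel₀ hne]

variable {Q : Matrix (Doubled n) (Doubled n) ℂ}

lemma exists_jForm_self_eq_one_of_ne_zero (hQ : IsDoubledUp Q) (hflat : flat Q = Q)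
    (hidem : Q * Q = Q) (hne : Q ≠ 0) : ∃ w, Q *ᵥ w = w ∧ jForm w w = 1 := by
  have hfix (x) : Q *ᵥ (Q *ᵥ x) = Q *ᵥ x := by rw [Matrix.mulVec_mulVec, hidem]
  obtain ⟨x, hx⟩ : ∃ x, jForm (Q *ᵥ x) (Q *ᵥ x) ≠ 0 := by
    by_contra! h
    have hB : jForm.compl₂ Q.mulVecLin = 0 := by
      refine sesqForm_eq_zero_of_forall_self fun x => ?_
      rw [LinearMap.compl₂_apply, Matrix.mulVecLin_apply, ← hfix, jForm_mulVec_right, hflat, h]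
    refine hne (Matrix.toLin'.injective (LinearMap.ext fun y => ?_))
    rw [map_zero]
    exact eq_zero_of_forall_jForm_eq_zero fun x => LinearMap.congr_fun₂ hB x y
  obtain ⟨w, hw, hpos⟩ : ∃ w, Q *ᵥ w = w ∧ 0 < (jForm w w).re := by
    have hre : (jForm (Q *ᵥ x) (Q *ᵥ x)).re ≠ 0 := fun h =>
      hx (by rw [← ofReal_re_jForm_self, h, Complex.ofReal_zero])
    rcases lt_or_gt_of_ne hre with hneg | hpos
    · refine ⟨conjVec (Q *ᵥ x), ?_, by simpa [jForm_conjVec_conjVec] using hneg⟩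
      nth_rw 1 [← isDoubledUp_iff.1 hQ]
      rw [← conjVec_mulVec, hfix]
    · exact ⟨Q *ᵥ x, hfix x, hpos⟩
  obtain ⟨c, hc⟩ := exists_jForm_smul_self_eq_one hpos
  exact ⟨c • w, by rw [Matrix.mulVec_smul, hw], hc⟩

lemma exists_orthogonal_jForm_self_eq_one (hQ : IsDoubledUp Q) (hflat : flat Q = Q)
    (hidem : Q * Q = Q) {P : Matrix (Doubled n) (Doubled d) ℂ} (hP : IsDoubledUp P)
    (hPP : flat P * P = 1) (hQP : Q * P = P) (hne : P * flat P ≠ Q) :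
    ∃ w, Q *ᵥ w = w ∧ flat P *ᵥ w = 0 ∧ jForm w w = 1 := by
  have hPQ : flat P * Q = flat P := by rw [← hflat, ← flat_mul, hQP]
  have hPPP : flat P * (P * flat P) = flat P := by rw [← Matrix.mul_assoc, hPP, Matrix.one_mul]
  obtain ⟨w, hw, hww⟩ : ∃ w, (Q - P * flat P) *ᵥ w = w ∧ jForm w w = 1 := by
    refine exists_jForm_self_eq_one_of_ne_zero ?_ ?_ ?_ (sub_ne_zero.2 hne.symm)
    · rw [isDoubledUp_iff, map_sub, isDoubledUp_iff.1 hQ, isDoubledUp_iff.1 (hP.mul hP.flat)]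
    · rw [flat_sub, flat_mul, flat_flat, hflat]
    · simp only [Matrix.sub_mul, Matrix.mul_sub, hidem, ← Matrix.mul_assoc Q, hQP,
        Matrix.mul_assoc P, hPQ, hPPP, sub_self, sub_zero]
  refine ⟨w, ?_, ?_, hww⟩
  · rw [← hw, Matrix.mulVec_mulVec, Matrix.mul_sub, hidem, ← Matrix.mul_assoc, hQP]
  · rw [← hw, Matrix.mulVec_mulVec, Matrix.mul_sub, hPQ, hPPP, sub_self, Matrix.zero_mulVec]

/-- Gram–Schmidt: a maximal symplectic family in the range of `Q` spans it. -/
theorem exists_isometry_mul_flat_eq (hQ : IsDoubledUp Q) (hflat : flat Q = Q)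
    (hidem : Q * Q = Q) :
    ∃ (d : ℕ) (P : Matrix (Doubled n) (Doubled d) ℂ),
      IsDoubledUp P ∧ flat P * P = 1 ∧ P * flat P = Q := by
  let D : Set ℕ := {d | ∃ p : Fin d → Doubled n → ℂ, SymplecticFamily p ∧ ∀ k, Q *ᵥ p k = p k}
  have hD : D.Nonempty := ⟨0, Fin.elim0, ⟨(Fin.elim0 ·), (Fin.elim0 ·)⟩, (Fin.elim0 ·)⟩
  have hbdd : BddAbove D := ⟨n, fun d ⟨p, hp, _⟩ => le_of_mul_eq_one_of_doubled hp.flat_mul_self⟩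
  obtain ⟨p, hp, hQp⟩ := Nat.sSup_mem hD hbdd
  have hQP : Q * doubledCols p = doubledCols p := by
    rw [mul_doubledCols hQ]
    exact congrArg doubledCols (funext hQp)
  refine ⟨_, doubledCols p, isDoubledUp_doubledCols p, hp.flat_mul_self, ?_⟩
  by_contra hne
  obtain ⟨w, hQw, hpw, hww⟩ := exists_orthogonal_jForm_self_eq_one hQ hflat hidem
    (isDoubledUp_doubledCols p) hp.flat_mul_self hQP hne
  have hsucc : sSup D + 1 ∈ D :=
    ⟨Fin.snoc p w, hp.snoc hww hpw, Fin.lastCases (by simpa using hQw) (by simpa using hQp)⟩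
  exact (le_csSup hbdd hsucc).not_gt (Nat.lt_succ_self _)

end SymplecticFrame

section SplitMode

variable {n : ℕ} {w : Doubled n → ℂ}

lemma symplecticFamily_const (hw : jForm w w = 1) : SymplecticFamily fun _ : Fin 1 => w :=
  ⟨fun i j => by rw [hw, if_pos (Subsingleton.elim i j)], fun _ _ => jForm_conjVec_self w⟩

lemma exists_isometry_add_eq_one (hw : jForm w w = 1) :
    ∃ (d : ℕ) (P : Matrix (Doubled n) (Doubled d) ℂ), d < n ∧ IsDoubledUp P ∧ flat P * P = 1 ∧
      flat P *ᵥ w = 0 ∧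
      P * flat P +
        doubledCols (fun _ : Fin 1 => w) * flat (doubledCols fun _ : Fin 1 => w) = 1 := by
  set W := doubledCols fun _ : Fin 1 => w with hW
  have hWd : IsDoubledUp W := isDoubledUp_doubledCols _
  have hWW : flat W * W = 1 := (symplecticFamily_const hw).flat_mul_self
  obtain ⟨d, P, hP, hPP, hPQ⟩ := exists_isometry_mul_flat_eq (Q := 1 - W * flat W)
    (by rw [isDoubledUp_iff, map_sub, conjMat_one, isDoubledUp_iff.1 (hWd.mul hWd.flat)])
    (by rw [flat_sub, flat_one, flat_mul, flat_flat])
    (by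
      have hidem : W * flat W * (W * flat W) = W * flat W := by
        rw [Matrix.mul_assoc, ← Matrix.mul_assoc (flat W), hWW, Matrix.one_mul]
      rw [Matrix.mul_sub, Matrix.mul_one, Matrix.sub_mul, Matrix.one_mul, hidem, sub_self,
        sub_zero])
  have hPW : flat P * W = 0 := by
    have h : flat P * (P * flat P * W) = 0 := by
      rw [hPQ, Matrix.sub_mul, Matrix.mul_assoc W, hWW, Matrix.mul_one, Matrix.one_mul, sub_self,
        Matrix.mul_zero]
    rwa [← Matrix.mul_assoc, ← Matrix.mul_assoc, hPP, Matrix.one_mul] at h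
  have hne : d ≠ n := by
    rintro rfl
    have hW0 : W = 0 := by
      rw [← Matrix.one_mul W, ← mul_eq_one_comm.1 hPP, Matrix.mul_assoc, hPW, Matrix.mul_zero]
    rw [hW0, Matrix.mul_zero] at hWW
    exact zero_ne_one hWW
  refine ⟨d, P, (le_of_mul_eq_one_of_doubled hPP).lt_of_ne hne, hP, hPP, ?_,
    by rw [hPQ, sub_add_cancel]⟩
  funext i
  exact congrFun₂ hPW i (.inl 0)

lemma mul_eq_of_flat_mulVec_eigenvector {A : Matrix (Doubled n) (Doubled n) ℂ}
    (hA : IsDoubledUp A) {z : ℂ} (hz : flat A *ᵥ w = z • w) {d : ℕ}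
    {P : Matrix (Doubled n) (Doubled d) ℂ} (hP : IsDoubledUp P) (hPw : flat P *ᵥ w = 0)
    (hPW : P * flat P +
      doubledCols (fun _ : Fin 1 => w) * flat (doubledCols fun _ : Fin 1 => w) = 1) :
    A * P = P * (flat P * A * P) := by
  set W := doubledCols fun _ : Fin 1 => w with hW
  have hPAW : flat P * flat A * W = 0 := by
    rw [hW, mul_doubledCols (hP.flat.mul hA.flat), ← Matrix.mulVec_mulVec, hz, Matrix.mulVec_smul,
      hPw, smul_zero]
    ext i (j | j) <;> simp [doubledCols]
  have hWAP : flat W * (A * P) = 0 := by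
    have h := congrArg flat hPAW
    rw [flat_mul, flat_mul, flat_flat, flat_flat] at h
    rw [h, flat, Matrix.conjTranspose_zero, Matrix.mul_zero, Matrix.zero_mul]
  calc A * P = (P * flat P + W * flat W) * (A * P) := by rw [hPW, Matrix.one_mul]
    _ = P * (flat P * A * P) := by
      rw [Matrix.add_mul, Matrix.mul_assoc W, hWAP, Matrix.mul_zero, add_zero]
      simp only [Matrix.mul_assoc]

end SplitMode

section PureInput

variable {v : Doubled 1 → ℂ}

lemma exists_vecMulVec_of_isPureInput {N M : Matrix (Fin 1) (Fin 1) ℂ} (h : IsPureInput N M) :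
    ∃ v : Doubled 1 → ℂ,
      jForm v v = 1 ∧ inputCovariance N M = Matrix.vecMulVec v (star v) := by
  obtain ⟨-, -, T, ⟨-, hT, hT'⟩, hV⟩ := h
  set e : Doubled 1 → ℂ := Pi.single (.inl 0) 1 with he
  have hvacuum : inputCovariance (0 : Matrix (Fin 1) (Fin 1) ℂ) 0 =
      Matrix.vecMulVec e (star e) := by
    ext (i | i) (j | j) <;> fin_cases i <;> fin_cases j <;>
      simp [inputCovariance, he, Matrix.vecMulVec_apply]
  refine ⟨flat T *ᵥ e, ?_, ?_⟩
  · rw [jForm_mulVec_left, flat_flat, Matrix.mulVec_mulVec, hT', Matrix.one_mulVec, jForm_apply]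
    simp [he]
  · have hTH : Tᴴ * (flat T)ᴴ = 1 := by
      rw [← Matrix.conjTranspose_mul, hT, Matrix.conjTranspose_one]
    calc inputCovariance N M = flat T * T * inputCovariance N M * (Tᴴ * (flat T)ᴴ) := by
          rw [hT, hTH, Matrix.one_mul, Matrix.mul_one]
      _ = flat T * (T * inputCovariance N M * Tᴴ) * (flat T)ᴴ := by
          simp only [Matrix.mul_assoc]
      _ = Matrix.vecMulVec (flat T *ᵥ e) (star (flat T *ᵥ e)) := by
          rw [hV, hvacuum, Matrix.mul_vecMulVec, Matrix.vecMulVec_mul, Matrix.star_mulVec]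

lemma eq_of_mulVec_eq_of_mulVec_conjVec_eq (hv : jForm v v = 1)
    {X Y : Matrix (Doubled 1) (Doubled 1) ℂ} (h : X *ᵥ v = Y *ᵥ v)
    (h' : X *ᵥ conjVec v = Y *ᵥ conjVec v) : X = Y := by
  set W := doubledCols fun _ : Fin 1 => v with hW
  have hWW : W * flat W = 1 := mul_eq_one_comm.1 (symplecticFamily_const hv).flat_mul_self
  have hXY : X * W = Y * W := by
    refine Matrix.ext_of_mulVec_single fun i => ?_
    simp only [← Matrix.mulVec_mulVec, hW, doubledCols_mulVec, Matrix.mulVec_sum,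
      Matrix.mulVec_add, Matrix.mulVec_smul, h, h']
  rw [← Matrix.mul_one X, ← hWW, ← Matrix.mul_assoc, hXY, Matrix.mul_assoc, hWW, Matrix.mul_one]

end PureInput

section Resolvent

variable {K ι κ : Type*} [Field K] [Fintype ι] [DecidableEq ι] [Fintype κ] [DecidableEq κ]

lemma resolvent_eq_inv (A : Matrix ι ι K) (s : K) :
    resolvent A s = (s • (1 : Matrix ι ι K) - A)⁻¹ := by
  rw [resolvent, Algebra.algebraMap_eq_smul_one, Matrix.nonsing_inv_eq_ringInverse]

lemma isUnit_smul_one_sub {A : Matrix ι ι K} {s : K} (hs : s ∉ spectrum K A) :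
    IsUnit (s • (1 : Matrix ι ι K) - A) := by
  simpa only [Algebra.algebraMap_eq_smul_one] using spectrum.notMem_iff.1 hs

lemma resolvent_mul_smul_one_sub {A : Matrix ι ι K} {s : K} (hs : s ∉ spectrum K A) :
    resolvent A s * (s • 1 - A) = 1 := by
  rw [resolvent_eq_inv, Matrix.nonsing_inv_mul _
    ((Matrix.isUnit_iff_isUnit_det _).1 (isUnit_smul_one_sub hs))]

lemma smul_one_sub_mul_resolvent {A : Matrix ι ι K} {s : K} (hs : s ∉ spectrum K A) :
    (s • 1 - A) * resolvent A s = 1 := by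
  rw [resolvent_eq_inv, Matrix.mul_nonsing_inv _
    ((Matrix.isUnit_iff_isUnit_det _).1 (isUnit_smul_one_sub hs))]

lemma resolvent_mul_of_mul_eq_mul {A : Matrix ι ι K} {B : Matrix κ κ K} {P : Matrix ι κ K}
    (h : A * P = P * B) {s : K} (hA : s ∉ spectrum K A) (hB : s ∉ spectrum K B) :
    resolvent A s * P = P * resolvent B s := by
  have hs : P * (s • 1 - B) = (s • 1 - A) * P := by
    rw [Matrix.mul_sub, Matrix.sub_mul, h, Matrix.mul_smul, Matrix.smul_mul, Matrix.mul_one,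
      Matrix.one_mul]
  calc resolvent A s * P
    _ = resolvent A s * (P * (s • 1 - B)) * resolvent B s := by
      rw [Matrix.mul_assoc, Matrix.mul_assoc, smul_one_sub_mul_resolvent hB, Matrix.mul_one]
    _ = P * resolvent B s := by
      rw [hs, ← Matrix.mul_assoc, resolvent_mul_smul_one_sub hA, Matrix.one_mul]

lemma mem_spectrum_iff_exists_mulVec {A : Matrix ι ι K} {z : K} :
    z ∈ spectrum K A ↔ ∃ x, x ≠ 0 ∧ A *ᵥ x = z • x := by
  rw [← Matrix.spectrum_toLin', ← Module.End.hasEigenvalue_iff_mem_spectrum]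
  constructor
  · intro h
    obtain ⟨x, hx⟩ := h.exists_hasEigenvector
    exact ⟨x, hx.2, by simpa using hx.apply_eq_smul⟩
  · rintro ⟨x, hx, h⟩
    exact Module.End.hasEigenvalue_of_hasEigenvector
      (x := x) ⟨Module.End.mem_eigenspace_iff.2 (by simpa using h), hx⟩

lemma spectrum_subset_of_mul_eq_mul {A : Matrix ι ι K} {B : Matrix κ κ K} {P : Matrix ι κ K}
    {L : Matrix κ ι K} (hP : L * P = 1) (h : A * P = P * B) : spectrum K B ⊆ spectrum K A := by
  intro z hz
  obtain ⟨x, hx, hBx⟩ := mem_spectrum_iff_exists_mulVec.1 hz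
  refine mem_spectrum_iff_exists_mulVec.2 ⟨P *ᵥ x, fun hPx => hx ?_, ?_⟩
  · rw [← Matrix.one_mulVec x, ← hP, ← Matrix.mulVec_mulVec, hPx, Matrix.mulVec_zero]
  · rw [Matrix.mulVec_mulVec, h, ← Matrix.mulVec_mulVec, hBx, Matrix.mulVec_smul]

end Resolvent

section Sylvester

open Polynomial

variable {K ι κ : Type*} [Field K] [Fintype ι] [DecidableEq ι] [Fintype κ] [DecidableEq κ]

lemma pow_mul_eq_mul_pow {A : Matrix ι ι K} {B : Matrix κ κ K} {X : Matrix κ ι K}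
    (h : B * X = X * A) (j : ℕ) : B ^ j * X = X * A ^ j := by
  induction j with
  | zero => simp
  | succ j ih =>
    rw [pow_succ, pow_succ', Matrix.mul_assoc, h, ← Matrix.mul_assoc, ih, Matrix.mul_assoc,
      ← pow_succ, ← pow_succ']

lemma aeval_mul_eq_mul_aeval {A : Matrix ι ι K} {B : Matrix κ κ K} {X : Matrix κ ι K}
    (h : B * X = X * A) (p : K[X]) : aeval B p * X = X * aeval A p := by
  simp only [aeval_eq_sum_range, Matrix.sum_mul, Matrix.mul_sum, Matrix.smul_mul,
    Matrix.mul_smul, pow_mul_eq_mul_pow h]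

theorem eq_zero_of_mul_eq_mul_of_disjoint_spectrum [IsAlgClosed K] {A : Matrix ι ι K}
    {B : Matrix κ κ K} {X : Matrix κ ι K} (h : B * X = X * A)
    (hAB : Disjoint (spectrum K A) (spectrum K B)) : X = 0 := by
  obtain ⟨p, q, hpq⟩ : IsCoprime A.charpoly B.charpoly := by
    rw [isCoprime_iff_aeval_ne_zero_of_isAlgClosed K K]
    intro z
    by_contra! hz
    simp only [coe_aeval_eq_eval] at hz
    exact Set.disjoint_left.1 hAB (Matrix.mem_spectrum_iff_isRoot_charpoly.2 hz.1)
      (Matrix.mem_spectrum_iff_isRoot_charpoly.2 hz.2)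
  have hB : aeval B (p * A.charpoly) = 1 := by
    simpa [Matrix.aeval_self_charpoly] using congrArg (aeval B) hpq
  rw [← Matrix.one_mul X, ← hB, aeval_mul_eq_mul_aeval h, map_mul, Matrix.aeval_self_charpoly,
    mul_zero, Matrix.mul_zero]

theorem eq_of_lyapunov_eq {A X Y Q : Matrix ι ι ℂ} (hA : ∀ z ∈ spectrum ℂ A, z.re < 0)
    (hX : X * A + Aᴴ * X + Q = 0) (hY : Y * A + Aᴴ * Y + Q = 0) : X = Y := by
  have hXY : (X - Y) * A + Aᴴ * (X - Y) = 0 := calc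
    _ = (X * A + Aᴴ * X + Q) - (Y * A + Aᴴ * Y + Q) := by
      rw [Matrix.sub_mul, Matrix.mul_sub]
      abel
    _ = 0 := by rw [hX, hY, sub_self]
  refine sub_eq_zero.1 (eq_zero_of_mul_eq_mul_of_disjoint_spectrum (A := A) (B := -Aᴴ) ?_ ?_)
  · rw [Matrix.neg_mul, neg_eq_of_add_eq_zero_left hXY]
  · rw [Set.disjoint_left]
    intro z hz hz'
    rw [← spectrum.neg_eq, Set.mem_neg, ← Matrix.star_eq_conjTranspose, spectrum.map_star,
      Set.mem_star] at hz'
    have hre := hA _ hz'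
    simp only [star_neg, Complex.neg_re, RCLike.star_def, Complex.conj_re] at hre
    linarith [hA z hz]

end Sylvester

section Realisation

variable {K α β ι κ : Type*} [Field K] [Fintype ι] [DecidableEq ι] [Fintype κ] [DecidableEq κ]

/-- Observability of the linear system `ẋ = A x`, `y = C x`. -/
def IsObservable (C : Matrix α ι K) (A : Matrix ι ι K) : Prop :=
  ∀ x : ι → K, (∀ j : ℕ, (C * A ^ j) *ᵥ x = 0) → x = 0

/-- Controllability of the linear system `ẋ = A x + B u`. -/
def IsControllable (A : Matrix ι ι K) (B : Matrix ι β K) : Prop :=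
  ∀ x : ι → K, (∀ j : ℕ, x ᵥ* (A ^ j * B) = 0) → x = 0

lemma isControllable_iff_isObservable_transpose {A : Matrix ι ι K} {B : Matrix ι β K} :
    IsControllable A B ↔ IsObservable Bᵀ Aᵀ := by
  simp only [IsControllable, IsObservable, ← Matrix.transpose_pow, ← Matrix.transpose_mul,
    Matrix.mulVec_transpose]

/-- The Popov–Belevitch–Hautus test. -/
theorem isObservable_of_eigenvector [IsAlgClosed K] {C : Matrix α ι K} {A : Matrix ι ι K}
    (h : ∀ (z : K) (x : ι → K), A *ᵥ x = z • x → C *ᵥ x = 0 → x = 0) : IsObservable C A := by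
  let N : Submodule K (ι → K) := ⨅ j : ℕ, (C * A ^ j).mulVecLin.ker
  have mem_N {x : ι → K} : x ∈ N ↔ ∀ j : ℕ, (C * A ^ j) *ᵥ x = 0 := by simp [N]
  have hN : ∀ x ∈ N, A.mulVecLin x ∈ N := fun x hx => mem_N.2 fun j => by
    rw [Matrix.mulVecLin_apply, Matrix.mulVec_mulVec, Matrix.mul_assoc, ← pow_succ]
    exact mem_N.1 hx (j + 1)
  suffices N = ⊥ from fun x hx => (Submodule.mem_bot K).1 (this ▸ mem_N.2 hx)
  by_contra hne
  have := Submodule.nontrivial_iff_ne_bot.2 hne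
  obtain ⟨z, hz⟩ := Module.End.exists_eigenvalue (A.mulVecLin.restrict hN)
  obtain ⟨⟨x, hx⟩, hxz⟩ := hz.exists_hasEigenvector
  refine hxz.2 (Subtype.ext (h z x (congrArg Subtype.val hxz.apply_eq_smul) ?_))
  simpa using mem_N.1 hx 0

theorem isControllable_of_eigenvector [IsAlgClosed K] {A : Matrix ι ι K} {B : Matrix ι β K}
    (h : ∀ (z : K) (x : ι → K), x ᵥ* A = z • x → x ᵥ* B = 0 → x = 0) : IsControllable A B :=
  isControllable_iff_isObservable_transpose.2 <| isObservable_of_eigenvector fun z x hA hB =>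
    h z x (by rw [← Matrix.mulVec_transpose, hA]) (by rw [← Matrix.mulVec_transpose, hB])

lemma IsObservable.ext {C : Matrix α κ K} {A : Matrix κ κ K} (h : IsObservable C A)
    {X Y : Matrix κ β K} (hXY : ∀ j, C * A ^ j * X = C * A ^ j * Y) : X = Y := by
  refine Matrix.ext_col fun b => sub_eq_zero.1 (h _ fun j => ?_)
  rw [Matrix.mulVec_sub, sub_eq_zero]
  exact congrArg (Matrix.col · b) (hXY j)

/-- The controllability map `(uⱼ) ↦ ∑ⱼ Aʲ B uⱼ`. -/
def controllabilityMap [Fintype β] (A : Matrix ι ι K) (B : Matrix ι β K) :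
    (ℕ →₀ (β → K)) →ₗ[K] (ι → K) :=
  Finsupp.lsum K fun j => (A ^ j * B).mulVecLin

@[simp] lemma controllabilityMap_single [Fintype β] (A : Matrix ι ι K) (B : Matrix ι β K) (j : ℕ)
    (u : β → K) : controllabilityMap A B (Finsupp.single j u) = (A ^ j * B) *ᵥ u := by
  simp [controllabilityMap]

lemma IsControllable.surjective [Fintype β] {A : Matrix ι ι K} {B : Matrix ι β K}
    (h : IsControllable A B) : Function.Surjective (controllabilityMap A B) := by
  rw [← LinearMap.range_eq_top]
  by_contra hne
  obtain ⟨f, hf, hle⟩ := Submodule.exists_le_ker_of_lt_top _ (lt_top_iff_ne_top.2 hne)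
  obtain ⟨x, rfl⟩ := (dotProductEquiv K ι).surjective f
  refine hf ((map_eq_zero_iff _ (dotProductEquiv K ι).injective).2 (h x fun j => ?_))
  refine dotProduct_eq_zero _ fun u => ?_
  rw [← Matrix.dotProduct_mulVec, ← controllabilityMap_single]
  exact hle ⟨_, rfl⟩

lemma mulVec_controllabilityMap [Fintype β] {A : Matrix ι ι K} {B : Matrix ι β K}
    (C : Matrix α ι K) (j : ℕ) (p : ℕ →₀ (β → K)) :
    (C * A ^ j) *ᵥ controllabilityMap A B p = p.sum fun i u => (C * A ^ (j + i) * B) *ᵥ u := by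
  simp only [controllabilityMap, Finsupp.lsum_apply, Finsupp.sum, Matrix.mulVec_sum,
    Matrix.mulVecLin_apply, Matrix.mulVec_mulVec, pow_add, Matrix.mul_assoc]

lemma exists_linearEquiv_of_surjective_of_ker_eq {M N N' : Type*} [AddCommGroup M] [Module K M]
    [AddCommGroup N] [Module K N] [AddCommGroup N'] [Module K N'] {f : M →ₗ[K] N}
    {f' : M →ₗ[K] N'} (hf : Function.Surjective f) (hf' : Function.Surjective f')
    (h : f.ker = f'.ker) : ∃ e : N ≃ₗ[K] N', ∀ p, e (f p) = f' p := by
  refine ⟨(f.quotKerEquivOfSurjective hf).symm ≪≫ₗ Submodule.quotEquivOfEq _ _ h ≪≫ₗ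
    f'.quotKerEquivOfSurjective hf', fun p => ?_⟩
  rw [LinearEquiv.trans_apply, LinearEquiv.trans_apply,
    ← LinearMap.quotKerEquivOfSurjective_apply_mk f hf, LinearEquiv.symm_apply_apply]
  rfl

theorem exists_similarity_of_markov_eq [Finite β] {A : Matrix ι ι K} {B : Matrix ι β K}
    {C : Matrix α ι K} {A' : Matrix κ κ K} {B' : Matrix κ β K} {C' : Matrix α κ K}
    (hO : IsObservable C A) (hK : IsControllable A B) (hO' : IsObservable C' A')
    (hK' : IsControllable A' B')
    (h : ∀ j, C * A ^ j * B = C' * A' ^ j * B') :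
    ∃ (T : Matrix κ ι K) (T' : Matrix ι κ K),
      T' * T = 1 ∧ T * T' = 1 ∧ T * A = A' * T ∧ T * B = B' ∧ C' * T = C := by
  classical
  cases nonempty_fintype β
  have hankel (j p) : (C * A ^ j) *ᵥ controllabilityMap A B p =
      (C' * A' ^ j) *ᵥ controllabilityMap A' B' p := by
    simp only [mulVec_controllabilityMap, h]
  have hker : (controllabilityMap A B).ker = (controllabilityMap A' B').ker := by
    ext p
    exact ⟨fun hp => hO' _ fun j => by rw [← hankel, LinearMap.mem_ker.1 hp, Matrix.mulVec_zero],
      fun hp => hO _ fun j => by rw [hankel, LinearMap.mem_ker.1 hp, Matrix.mulVec_zero]⟩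
  obtain ⟨e, he⟩ := exists_linearEquiv_of_surjective_of_ker_eq hK.surjective hK'.surjective hker
  have hT (p) : LinearMap.toMatrix' e.toLinearMap *ᵥ controllabilityMap A B p =
      controllabilityMap A' B' p := by
    rw [LinearMap.toMatrix'_mulVec]
    exact he p
  set T := LinearMap.toMatrix' e.toLinearMap
  have hobs (j) : C' * A' ^ j * T = C * A ^ j := by
    refine Matrix.ext_of_mulVec_single fun i => ?_
    obtain ⟨p, hp⟩ := hK.surjective (Pi.single i 1)
    rw [← hp, ← Matrix.mulVec_mulVec, hT, hankel]
  refine ⟨T, LinearMap.toMatrix' e.symm.toLinearMap, ?_, ?_, hO'.ext fun j => ?_, ?_, ?_⟩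
  · simp [T, ← LinearMap.toMatrix'_comp]
  · simp [T, ← LinearMap.toMatrix'_comp]
  · rw [← Matrix.mul_assoc, hobs, Matrix.mul_assoc, ← pow_succ, ← hobs, pow_succ]
    simp only [Matrix.mul_assoc]
  · refine Matrix.ext_of_mulVec_single fun i => ?_
    simpa only [controllabilityMap_single, pow_zero, Matrix.one_mul, Matrix.mulVec_mulVec]
      using hT (Finsupp.single 0 (Pi.single i 1))
  · simpa using hobs 0

end Realisation

lemma IsObservable.isDoubledUp_of_similarity {m k l : ℕ} {A : Matrix (Doubled k) (Doubled k) ℂ}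
    {C : Matrix (Doubled m) (Doubled k) ℂ} {A' : Matrix (Doubled l) (Doubled l) ℂ}
    {C' : Matrix (Doubled m) (Doubled l) ℂ} {T : Matrix (Doubled l) (Doubled k) ℂ}
    (hO : IsObservable C' A') (hA : IsDoubledUp A) (hC : IsDoubledUp C) (hA' : IsDoubledUp A')
    (hC' : IsDoubledUp C') (hTA : T * A = A' * T) (hTC : C' * T = C) : IsDoubledUp T := by
  have hobs (j) : C' * A' ^ j * T = C * A ^ j := by
    rw [Matrix.mul_assoc, pow_mul_eq_mul_pow hTA.symm, ← Matrix.mul_assoc, hTC]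
  rw [isDoubledUp_iff] at *
  refine hO.ext fun j => ?_
  have hconj := congrArg conjMat (hobs j)
  rwa [conjMat_mul, conjMat_mul, conjMat_mul, conjMat_pow, conjMat_pow, hA, hC, hA', hC',
    ← hobs] at hconj

section Asymptotics

open Filter Topology Bornology

variable {α β ι κ : Type*} [Fintype ι] [DecidableEq ι] [Fintype κ] [DecidableEq κ]

lemma tendsto_resolvent (A : Matrix ι ι ℂ) : Tendsto (resolvent A) (cobounded ℂ) (𝓝 0) := by
  let _ := Matrix.linftyOpNormedRing (n := ι) (α := ℂ)
  let _ := Matrix.linftyOpNormedAlgebra (R := ℂ) (n := ι) (α := ℂ)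
  exact spectrum.resolvent_tendsto_cobounded A

lemma differentiableAt_resolvent_mulVec {A : Matrix ι ι ℂ} {s : ℂ} (hs : s ∉ spectrum ℂ A)
    (x : ι → ℂ) : DifferentiableAt ℂ (fun s => resolvent A s *ᵥ x) s := by
  let _ := Matrix.linftyOpNormedRing (n := ι) (α := ℂ)
  let _ := Matrix.linftyOpNormedAlgebra (R := ℂ) (n := ι) (α := ℂ)
  exact ((Matrix.mulVecBilin ℂ ℂ).flip x).toContinuousLinearMap.differentiableAt.comp s
    (spectrum.hasDerivAt_resolvent_const_left (spectrum.notMem_iff.1 hs)).differentiableAt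

lemma tendsto_mul_resolvent_mul (A : Matrix ι ι ℂ) (C : Matrix α ι ℂ) (B : Matrix ι β ℂ) :
    Tendsto (fun s => C * resolvent A s * B) (cobounded ℂ) (𝓝 0) := by
  have hcont : Continuous fun X : Matrix ι ι ℂ => C * X * B := by fun_prop
  simpa [Function.comp_def] using (hcont.tendsto 0).comp (tendsto_resolvent A)

lemma eventually_notMem_spectrum (A : Matrix ι ι ℂ) : ∀ᶠ s in cobounded ℂ, s ∉ spectrum ℂ A :=
  isBounded_def.1 A.finite_spectrum.isBounded

lemma tendsto_neg_I_mul_atTop : Tendsto (fun ω : ℝ => -(Complex.I * ω)) atTop (cobounded ℂ) := by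
  rw [← tendsto_norm_atTop_iff_cobounded]
  simpa using tendsto_abs_atTop_atTop

lemma smul_mul_resolvent_mul {A : Matrix ι ι ℂ} {s : ℂ} (hs : s ∉ spectrum ℂ A)
    (C : Matrix α ι ℂ) (B : Matrix ι β ℂ) :
    s • (C * resolvent A s * B) = C * B + C * resolvent A s * (A * B) := by
  have h := resolvent_mul_smul_one_sub hs
  rw [Matrix.mul_sub, Matrix.mul_smul, Matrix.mul_one, sub_eq_iff_eq_add] at h
  rw [← Matrix.smul_mul, ← Matrix.mul_smul, h, Matrix.mul_add, Matrix.add_mul, Matrix.mul_one]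
  simp only [Matrix.mul_assoc]

variable {l : Filter ℂ} [l.NeBot] {A : Matrix ι ι ℂ} {B : Matrix ι β ℂ} {C : Matrix α ι ℂ}
  {A' : Matrix κ κ ℂ} {B' : Matrix κ β ℂ} {C' : Matrix α κ ℂ}

lemma mul_eq_of_eventually_resolvent_eq (hl : l ≤ cobounded ℂ)
    (h : ∀ᶠ s in l, C * resolvent A s * B = C' * resolvent A' s * B') :
    C * B = C' * B' ∧
      ∀ᶠ s in l, C * resolvent A s * (A * B) = C' * resolvent A' s * (A' * B') := by
  have hshift : ∀ᶠ s in l, C * B + C * resolvent A s * (A * B) =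
      C' * B' + C' * resolvent A' s * (A' * B') := by
    filter_upwards [h, hl (eventually_notMem_spectrum A), hl (eventually_notMem_spectrum A')]
      with s hs hA hA'
    rw [← smul_mul_resolvent_mul hA, ← smul_mul_resolvent_mul hA', hs]
  have hCB : C * B = C' * B' := by
    have hlim := ((tendsto_mul_resolvent_mul A C (A * B)).mono_left hl).const_add (C * B)
    have hlim' := ((tendsto_mul_resolvent_mul A' C' (A' * B')).mono_left hl).const_add (C' * B')
    rw [add_zero] at hlim hlim'
    exact tendsto_nhds_unique (hlim.congr' hshift) hlim'
  refine ⟨hCB, hshift.mono fun s hs => ?_⟩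
  rw [hCB] at hs
  exact add_left_cancel hs

theorem mul_pow_mul_eq_of_eventually_resolvent_eq (hl : l ≤ cobounded ℂ)
    (h : ∀ᶠ s in l, C * resolvent A s * B = C' * resolvent A' s * B') (j : ℕ) :
    C * A ^ j * B = C' * A' ^ j * B' := by
  have hj : ∀ᶠ s in l, C * resolvent A s * (A ^ j * B) = C' * resolvent A' s * (A' ^ j * B') := by
    induction j with
    | zero => simpa only [pow_zero, Matrix.one_mul] using h
    | succ j ih =>
      simpa only [pow_succ', Matrix.mul_assoc] using (mul_eq_of_eventually_resolvent_eq hl ih).2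
  simpa only [Matrix.mul_assoc] using (mul_eq_of_eventually_resolvent_eq hl hj).1

end Asymptotics

section HalfPlane

open Filter Topology Bornology Matrix

lemma isOpen_rightHalfPlane : IsOpen {z : ℂ | 0 < z.re} :=
  isOpen_lt continuous_const Complex.continuous_re

lemma norm_le_of_tendsto_cobounded {E : Type*} [NormedAddCommGroup E] [NormedSpace ℂ E]
    {f : ℂ → E} {c : E} {M : ℝ} (hd : DiffContOnCl ℂ f {z | 0 < z.re})
    (hlim : Tendsto f (cobounded ℂ) (𝓝 c)) (him : ∀ y : ℝ, ‖f (y * Complex.I)‖ ≤ M) {z : ℂ}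
    (hz : 0 ≤ z.re) : ‖f z‖ ≤ M := by
  refine PhragmenLindelof.right_half_plane_of_bounded_on_real hd ⟨0, by norm_num, 0, ?_⟩ ?_ him hz
  · simpa only [zero_mul, Real.exp_zero] using (hlim.isBigO_one ℝ).mono inf_le_left
  · exact (hlim.comp (RCLike.tendsto_ofReal_atTop_cobounded ℂ)).norm.isBoundedUnder_le

lemma eq_of_tendsto_of_mul_eq_one {f g : ℂ → ℂ} {c c' : ℂ} (hf : DiffContOnCl ℂ f {z | 0 < z.re})
    (hg : DiffContOnCl ℂ g {z | 0 < z.re}) (hflim : Tendsto f (cobounded ℂ) (𝓝 c))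
    (hglim : Tendsto g (cobounded ℂ) (𝓝 c')) (hfi : ∀ y : ℝ, ‖f (y * Complex.I)‖ ≤ 1)
    (hgi : ∀ y : ℝ, ‖g (y * Complex.I)‖ ≤ 1) (hfg : ∀ z : ℂ, 0 ≤ z.re → f z * g z = 1) {z : ℂ}
    (hz : 0 ≤ z.re) : f z = c := by
  have hf_le {z : ℂ} : 0 ≤ z.re → ‖f z‖ ≤ 1 := norm_le_of_tendsto_cobounded hf hflim hfi
  have hg_le {z : ℂ} : 0 ≤ z.re → ‖g z‖ ≤ 1 := norm_le_of_tendsto_cobounded hg hglim hgi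
  have one_le {z : ℂ} (hz : 0 ≤ z.re) : 1 ≤ ‖f z‖ := by
    rw [← norm_one (α := ℂ), ← hfg z hz, norm_mul]
    exact mul_le_of_le_one_right (norm_nonneg _) (hg_le hz)
  have hmem : (1 : ℂ) ∈ {z : ℂ | 0 < z.re} := by simp
  have hmax : IsMaxOn (norm ∘ f) {z : ℂ | 0 < z.re} 1 := fun w hw =>
    (hf_le (le_of_lt hw)).trans (one_le (by simp))
  have hconst := Complex.eqOn_closure_of_isPreconnected_of_isMaxOn_norm
    (convex_halfSpace_re_gt 0).isPreconnected isOpen_rightHalfPlane hf hmem hmax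
  rw [Complex.closure_setOfPred_lt_re] at hconst
  have hlim : Tendsto (fun x : ℝ => f x) atTop (𝓝 c) :=
    hflim.comp (RCLike.tendsto_ofReal_atTop_cobounded ℂ)
  refine (hconst hz).trans (tendsto_nhds_unique (tendsto_const_nhds.congr' ?_) hlim)
  filter_upwards [eventually_ge_atTop 0] with x hx
  exact (hconst (x := (x : ℂ)) (by simpa using hx)).symm

variable {ι : Type*} [Fintype ι]

/-- The quotient `w₂† w₁ / w₂† w₂`, which is the factor `c` when `w₁ = c w₂`. -/
def ratio (w₁ w₂ : ι → ℂ) : ℂ := (star w₂ ⬝ᵥ w₁) / (star w₂ ⬝ᵥ w₂)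

open scoped ComplexOrder in
lemma star_dotProduct_self_ne_zero {w : ι → ℂ} (hw : w ≠ 0) : star w ⬝ᵥ w ≠ 0 :=
  mt dotProduct_star_self_eq_zero.1 hw

lemma ratio_smul {w₁ w₂ : ι → ℂ} (hw₂ : w₂ ≠ 0) (h : vecMulVec w₁ w₂ = vecMulVec w₂ w₁) :
    ratio w₁ w₂ • w₂ = w₁ := by
  have hmul := congrArg (star w₂ ᵥ* ·) h
  simp only [vecMul_vecMulVec] at hmul
  rw [ratio, div_eq_inv_mul, mul_smul, hmul, inv_smul_smul₀ (star_dotProduct_self_ne_zero hw₂)]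

lemma ratio_mul_ratio {w₁ w₂ : ι → ℂ} (hw₁ : w₁ ≠ 0) (hw₂ : w₂ ≠ 0)
    (h : vecMulVec w₁ w₂ = vecMulVec w₂ w₁) : ratio w₁ w₂ * ratio w₂ w₁ = 1 := by
  refine smul_left_injective ℂ hw₁ ?_
  simp only [mul_smul, ratio_smul hw₁ h.symm, ratio_smul hw₂ h, one_smul]

lemma vecMulVec_comm_of_vecMulVec_star_eq {κ : Type*} [Finite κ] {w₁ w₂ : κ → ℂ} (hw₁ : w₁ ≠ 0)
    (h : vecMulVec w₁ (star w₁) = vecMulVec w₂ (star w₂)) :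
    vecMulVec w₁ w₂ = vecMulVec w₂ w₁ := by
  cases nonempty_fintype κ
  obtain ⟨c, hc⟩ : ∃ c : ℂ, w₁ = c • w₂ := by
    refine ⟨(star w₁ ⬝ᵥ w₁)⁻¹ * (star w₂ ⬝ᵥ w₁), ?_⟩
    have hmul := congrArg (· *ᵥ w₁) h
    simp only [vecMulVec_mulVec, op_smul_eq_smul] at hmul
    rw [mul_smul, ← hmul, inv_smul_smul₀ (star_dotProduct_self_ne_zero hw₁)]
  rw [hc, smul_vecMulVec, vecMulVec_smul]

lemma norm_ratio {w₁ w₂ : ι → ℂ} (hw₁ : w₁ ≠ 0) (hw₂ : w₂ ≠ 0)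
    (h : vecMulVec w₁ (star w₁) = vecMulVec w₂ (star w₂)) : ‖ratio w₁ w₂‖ = 1 := by
  obtain ⟨k, hk⟩ := Function.ne_iff.1 hw₂
  have hsmul := congrFun (ratio_smul hw₂ (vecMulVec_comm_of_vecMulVec_star_eq hw₁ h)) k
  have hkk := congrArg norm (congrFun₂ h k k)
  simp only [vecMulVec_apply, Pi.star_apply, norm_mul, norm_star] at hkk
  have hnorm : ‖w₁ k‖ = ‖w₂ k‖ := (mul_self_inj (norm_nonneg _) (norm_nonneg _)).1 hkk
  refine mul_right_cancel₀ (norm_ne_zero_iff.2 hk) ?_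
  rw [one_mul, ← norm_mul, ← smul_eq_mul, ← Pi.smul_apply, hsmul, hnorm]

variable {w₁ w₂ : ℂ → ι → ℂ} {v : ι → ℂ}

lemma diffContOnCl_apply (h : DiffContOnCl ℂ w₁ {z | 0 < z.re}) (j : ι) :
    DiffContOnCl ℂ (fun s => w₁ s j) {z | 0 < z.re} :=
  (ContinuousLinearMap.proj (R := ℂ) (φ := fun _ : ι => ℂ) j).differentiable.comp_diffContOnCl h

lemma diffContOnCl_ratio (hd₁ : DiffContOnCl ℂ w₁ {z | 0 < z.re})
    (hd₂ : DiffContOnCl ℂ w₂ {z | 0 < z.re}) (hw₂ : ∀ s : ℂ, 0 ≤ s.re → w₂ s ≠ 0)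
    (h : ∀ s : ℂ, 0 ≤ s.re → vecMulVec (w₁ s) (w₂ s) = vecMulVec (w₂ s) (w₁ s)) :
    DiffContOnCl ℂ (fun s => ratio (w₁ s) (w₂ s)) {z | 0 < z.re} := by
  constructor
  · intro s hs
    have hdiff {w : ℂ → ι → ℂ} (hd : DiffContOnCl ℂ w {z | 0 < z.re}) (k : ι) :
        DifferentiableAt ℂ (fun s => w s k) s :=
      (diffContOnCl_apply hd k).differentiableOn.differentiableAt
        (isOpen_rightHalfPlane.mem_nhds hs)
    obtain ⟨k, hk⟩ := Function.ne_iff.1 (hw₂ s (le_of_lt hs))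
    refine (((hdiff hd₁ k).div (hdiff hd₂ k) hk).congr_of_eventuallyEq ?_).differentiableWithinAt
    filter_upwards [(hdiff hd₂ k).continuousAt.eventually_ne hk,
      isOpen_rightHalfPlane.mem_nhds hs] with t hkt ht
    have ht' : 0 ≤ t.re := le_of_lt ht
    exact eq_div_of_mul_eq hkt (congrFun (ratio_smul (hw₂ t ht') (h t ht')) k)
  · rw [Complex.closure_setOfPred_lt_re]
    have hcont {w : ℂ → ι → ℂ} (hd : DiffContOnCl ℂ w {z | 0 < z.re}) (k : ι) :
        ContinuousOn (fun s => w s k) {z | 0 ≤ z.re} := by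
      rw [← Complex.closure_setOfPred_lt_re]
      exact (diffContOnCl_apply hd k).continuousOn
    refine ContinuousOn.div ?_ ?_ fun s hs => star_dotProduct_self_ne_zero (hw₂ s hs)
    · exact continuousOn_finsetSum _ fun k _ => (hcont hd₂ k).star.mul (hcont hd₁ k)
    · exact continuousOn_finsetSum _ fun k _ => (hcont hd₂ k).star.mul (hcont hd₂ k)

lemma tendsto_ratio {l : Filter ℂ} (hv : v ≠ 0) (h₁ : Tendsto w₁ l (𝓝 v))
    (h₂ : Tendsto w₂ l (𝓝 v)) : Tendsto (fun s => ratio (w₁ s) (w₂ s)) l (𝓝 1) := by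
  have hself := star_dotProduct_self_ne_zero hv
  rw [← div_self hself]
  rw [tendsto_pi_nhds] at h₁ h₂
  exact (tendsto_finsetSum _ fun k _ => (h₂ k).star.mul (h₁ k)).div
    (tendsto_finsetSum _ fun k _ => (h₂ k).star.mul (h₂ k)) hself

lemma vecMulVec_comm_of_axis (hd₁ : DiffContOnCl ℂ w₁ {z | 0 < z.re})
    (hd₂ : DiffContOnCl ℂ w₂ {z | 0 < z.re}) {v₂ : ι → ℂ} (h₁ : Tendsto w₁ (cobounded ℂ) (𝓝 v))
    (h₂ : Tendsto w₂ (cobounded ℂ) (𝓝 v₂))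
    (haxis : ∀ y : ℝ, vecMulVec (w₁ (y * Complex.I)) (w₂ (y * Complex.I)) =
      vecMulVec (w₂ (y * Complex.I)) (w₁ (y * Complex.I))) {s : ℂ} (hs : 0 ≤ s.re) :
    vecMulVec (w₁ s) (w₂ s) = vecMulVec (w₂ s) (w₁ s) := by
  ext i j
  rw [tendsto_pi_nhds] at h₁ h₂
  rw [← sub_eq_zero, ← norm_le_zero_iff]
  refine norm_le_of_tendsto_cobounded (f := fun s => w₁ s i * w₂ s j - w₂ s i * w₁ s j)
    (((diffContOnCl_apply hd₁ i).smul (diffContOnCl_apply hd₂ j)).sub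
      ((diffContOnCl_apply hd₂ i).smul (diffContOnCl_apply hd₁ j)))
    (((h₁ i).mul (h₂ j)).sub ((h₂ i).mul (h₁ j))) (fun y => ?_) hs
  exact norm_le_zero_iff.2 (sub_eq_zero.2 (congrFun₂ (haxis y) i j))

theorem eq_of_vecMulVec_star_eq (hv : v ≠ 0) (hd₁ : DiffContOnCl ℂ w₁ {z | 0 < z.re})
    (hd₂ : DiffContOnCl ℂ w₂ {z | 0 < z.re}) (h₁ : Tendsto w₁ (cobounded ℂ) (𝓝 v))
    (h₂ : Tendsto w₂ (cobounded ℂ) (𝓝 v)) (hw₁ : ∀ s : ℂ, 0 ≤ s.re → w₁ s ≠ 0)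
    (hw₂ : ∀ s : ℂ, 0 ≤ s.re → w₂ s ≠ 0)
    (haxis : ∀ y : ℝ, vecMulVec (w₁ (y * Complex.I)) (star (w₁ (y * Complex.I))) =
      vecMulVec (w₂ (y * Complex.I)) (star (w₂ (y * Complex.I)))) {s : ℂ} (hs : 0 ≤ s.re) :
    w₁ s = w₂ s := by
  have hre (y : ℝ) : 0 ≤ (y * Complex.I : ℂ).re := by simp
  have hcomm (s : ℂ) : 0 ≤ s.re → vecMulVec (w₁ s) (w₂ s) = vecMulVec (w₂ s) (w₁ s) :=
    vecMulVec_comm_of_axis hd₁ hd₂ h₁ h₂ fun y =>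
      vecMulVec_comm_of_vecMulVec_star_eq (hw₁ _ (hre y)) (haxis y)
  have hratio : ratio (w₁ s) (w₂ s) = 1 :=
    eq_of_tendsto_of_mul_eq_one (f := fun s => ratio (w₁ s) (w₂ s))
      (g := fun s => ratio (w₂ s) (w₁ s))
      (diffContOnCl_ratio hd₁ hd₂ hw₂ hcomm)
      (diffContOnCl_ratio hd₂ hd₁ hw₁ fun s hs => (hcomm s hs).symm)
      (tendsto_ratio hv h₁ h₂) (tendsto_ratio hv h₂ h₁)
      (fun y => (norm_ratio (hw₁ _ (hre y)) (hw₂ _ (hre y)) (haxis y)).le)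
      (fun y => (norm_ratio (hw₂ _ (hre y)) (hw₁ _ (hre y)) (haxis y).symm).le)
      (fun z hz => ratio_mul_ratio (hw₁ z hz) (hw₂ z hz) (hcomm z hz)) hs
  rw [← ratio_smul (hw₂ s hs) (hcomm s hs), hratio, one_smul]

end HalfPlane

section Similarity

variable {m n k : ℕ} {A₀ : Matrix (Doubled k) (Doubled k) ℂ} {B₀ : Matrix (Doubled k) (Doubled m) ℂ}
  {C₀ : Matrix (Doubled m) (Doubled k) ℂ} {A : Matrix (Doubled n) (Doubled n) ℂ}
  {B : Matrix (Doubled n) (Doubled m) ℂ} {C : Matrix (Doubled m) (Doubled n) ℂ}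
  {Ξ : ℝ → Matrix (Doubled m) (Doubled m) ℂ}

open Filter in
theorem IsMinimalClassicalRealisation.exists_similarity
    (h₀ : IsMinimalClassicalRealisation A₀ B₀ C₀ Ξ) (h : IsMinimalClassicalRealisation A B C Ξ) :
    ∃ (T : Matrix (Doubled n) (Doubled k) ℂ) (T' : Matrix (Doubled k) (Doubled n) ℂ),
      IsDoubledUp T ∧ T' * T = 1 ∧ T * T' = 1 ∧ T * A₀ = A * T ∧ C * T = C₀ := by
  have htransfer : ∀ᶠ s in atTop.map fun ω : ℝ => -(Complex.I * ω),
      C₀ * resolvent A₀ s * B₀ = C * resolvent A s * B := by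
    rw [eventually_map]
    filter_upwards [tendsto_neg_I_mul_atTop (eventually_notMem_spectrum A₀),
      tendsto_neg_I_mul_atTop (eventually_notMem_spectrum A)] with ω hω₀ hω
    rw [resolvent_eq_inv, resolvent_eq_inv]
    exact add_left_cancel ((h₀.transfer_eq ω hω₀).symm.trans (h.transfer_eq ω hω))
  obtain ⟨T, T', hT'T, hTT', hTA, -, hCT⟩ := exists_similarity_of_markov_eq h₀.observable
    h₀.controllable h.observable h.controllable
    (mul_pow_mul_eq_of_eventually_resolvent_eq tendsto_neg_I_mul_atTop htransfer)
  exact ⟨T, T', IsObservable.isDoubledUp_of_similarity h.observable h₀.doubledUp_A h₀.doubledUp_C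
    h.doubledUp_A h.doubledUp_C hTA hCT, hT'T, hTT', hTA, hCT⟩

end Similarity

section Hurwitz

variable {n : ℕ} {A : Matrix (Doubled n) (Doubled n) ℂ}

lemma IsHurwitzMatrix.notMem_spectrum (hA : IsHurwitzMatrix A) {s : ℂ} (hs : 0 ≤ s.re) :
    s ∉ spectrum ℂ A := fun h => (hA s h).not_ge hs

lemma IsHurwitzMatrix.of_mul_eq_mul {d : ℕ} (hA : IsHurwitzMatrix A)
    {B : Matrix (Doubled d) (Doubled d) ℂ} {P : Matrix (Doubled n) (Doubled d) ℂ}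
    {L : Matrix (Doubled d) (Doubled n) ℂ} (hP : L * P = 1) (h : A * P = P * B) :
    IsHurwitzMatrix B :=
  fun z hz => hA z (spectrum_subset_of_mul_eq_mul hP h hz)

lemma IsHurwitzMatrix.eq_zero_of_flat_mulVec (hA : IsHurwitzMatrix A) {z : ℂ} (hz : 0 ≤ z.re)
    {x : Doubled n → ℂ} (hx : flat A *ᵥ x = z • x) : x = 0 := by
  have hJx : Aᴴ *ᵥ (J n *ᵥ x) = z • (J n *ᵥ x) := by
    rw [← Matrix.mulVec_smul, ← hx, Matrix.mulVec_mulVec, Matrix.mulVec_mulVec, flat,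
      Matrix.mul_assoc, J_mul_cancel]
  by_contra hne
  have hJne : J n *ᵥ x ≠ 0 := fun h0 => hne <| by
    rw [← Matrix.one_mulVec x, ← J_mul_J, ← Matrix.mulVec_mulVec, h0, Matrix.mulVec_zero]
  have hmem : z ∈ spectrum ℂ (star A) := mem_spectrum_iff_exists_mulVec.2 ⟨_, hJne, hJx⟩
  rw [spectrum.map_star] at hmem
  exact hA.notMem_spectrum (by simpa using hz) hmem

end Hurwitz

namespace System

section StateSpace

variable {m n : ℕ}

lemma J_mul_Ω (G : System m n) :
    J n * G.Ω = Complex.I • (G.A + (1 / 2 : ℂ) • (QLin.flat G.C * G.C)) := by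
  rw [A, sub_add_eq_add_sub, neg_add_cancel, zero_sub, smul_neg, smul_smul, Complex.I_mul_I,
    neg_one_smul, neg_neg]

lemma A_add_flat_A (G : System m n) : G.A + QLin.flat G.A + QLin.flat G.C * G.C = 0 := by
  have hΩ : QLin.flat (J n * G.Ω) = J n * G.Ω := by
    rw [flat_mul, flat_J, QLin.flat, G.hermitian_Ω.eq, mul_J_cancel]
  have hhalf : star (1 / 2 : ℂ) = 1 / 2 := by simp
  have hI : star Complex.I = -Complex.I := by simp
  rw [A, ← neg_smul, flat_sub, flat_smul, flat_smul, flat_mul, flat_flat, hΩ, star_neg, hhalf, hI]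
  module

lemma flat_A_mulVec (G : System m n) (x : Doubled n → ℂ) :
    QLin.flat G.A *ᵥ x = -(G.A *ᵥ x) - QLin.flat G.C *ᵥ (G.C *ᵥ x) := by
  have h := congrArg (· *ᵥ x) G.A_add_flat_A
  simp only [Matrix.add_mulVec, ← Matrix.mulVec_mulVec, Matrix.zero_mulVec] at h
  linear_combination (exp := 1) h

lemma isDoubledUp_A (G : System m n) : IsDoubledUp G.A := by
  have hhalf : star (1 / 2 : ℂ) = 1 / 2 := by simp
  rw [isDoubledUp_iff, A]
  simp only [map_sub, map_neg, map_smulₛₗ, conjMat_mul, conjMat_flat, conjMat_J,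
    isDoubledUp_iff.1 G.doubledUp_C, isDoubledUp_iff.1 G.doubledUp_Ω, starRingEnd_apply, hhalf]
  simp

lemma eq_of_A_eq {G K : System m n} (hS : G.S = K.S) (hC : G.C = K.C) (hA : G.A = K.A) :
    G = K := by
  have hΩ : G.Ω = K.Ω := by
    rw [← J_mul_cancel G.Ω, ← J_mul_cancel K.Ω, J_mul_Ω, J_mul_Ω, hA, hC]
  cases G
  cases K
  simp_all

lemma lyapunov_of_mul_eq_mul (G : System m n) {k : ℕ} {A₀ : Matrix (Doubled k) (Doubled k) ℂ}
    {C₀ : Matrix (Doubled m) (Doubled k) ℂ} {R : Matrix (Doubled n) (Doubled k) ℂ}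
    (hA : R * A₀ = G.A * R) (hC : G.C * R = C₀) :
    (Rᴴ * J n * R) * A₀ + A₀ᴴ * (Rᴴ * J n * R) + C₀ᴴ * J m * C₀ = 0 := by
  have hA' : A₀ᴴ * Rᴴ = Rᴴ * G.Aᴴ := by
    rw [← Matrix.conjTranspose_mul, hA, Matrix.conjTranspose_mul]
  calc (Rᴴ * J n * R) * A₀ + A₀ᴴ * (Rᴴ * J n * R) + C₀ᴴ * J m * C₀
      = Rᴴ * J n * (R * A₀) + A₀ᴴ * Rᴴ * (J n * R) + C₀ᴴ * J m * C₀ := by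
        simp only [Matrix.mul_assoc]
    _ = Rᴴ * (J n * (G.A + QLin.flat G.A + QLin.flat G.C * G.C)) * R := by
        rw [hA, hA', ← hC, QLin.flat, QLin.flat]
        simp only [Matrix.conjTranspose_mul, Matrix.mul_add, Matrix.add_mul, Matrix.mul_assoc,
          J_mul_cancel]
    _ = 0 := by rw [G.A_add_flat_A, Matrix.mul_zero, Matrix.mul_zero, Matrix.zero_mul]

lemma lyapunov (G : System m n) : J n * G.A + G.Aᴴ * J n + G.Cᴴ * J m * G.C = 0 := by
  simpa using G.lyapunov_of_mul_eq_mul (R := 1) (A₀ := G.A) (by simp) (by simp)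

lemma IsHurwitz.eq_zero_of_C_mulVec_eq_zero {G : System m n} (hG : G.IsHurwitz) {z : ℂ}
    {x : Doubled n → ℂ} (hA : G.A *ᵥ x = z • x) (hC : G.C *ᵥ x = 0) : x = 0 := by
  by_contra hx
  have hz : z.re < 0 := hG z (mem_spectrum_iff_exists_mulVec.2 ⟨x, hx, hA⟩)
  refine hx (IsHurwitzMatrix.eq_zero_of_flat_mulVec hG (z := -z) (by simpa using hz.le) ?_)
  rw [G.flat_A_mulVec, hA, hC, Matrix.mulVec_zero, sub_zero, neg_smul]

lemma IsHurwitz.isObservable {G : System m n} (hG : G.IsHurwitz) : IsObservable G.C G.A :=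
  isObservable_of_eigenvector fun _ _ => hG.eq_zero_of_C_mulVec_eq_zero

lemma IsHurwitz.isControllable {G : System m n} (hG : G.IsHurwitz) :
    IsControllable G.A (-QLin.flat G.C) := by
  refine isControllable_of_eigenvector fun z x hA hB => ?_
  set y := J n *ᵥ star x with hy
  have hJy : J n *ᵥ y = star x := by
    rw [hy, Matrix.mulVec_mulVec, J_mul_J, Matrix.one_mulVec]
  have hCy : G.C *ᵥ y = 0 := by
    have hJ : J m * (QLin.flat G.C)ᴴ * J n = G.C := flat_flat G.C
    rw [Matrix.vecMul_neg, neg_eq_zero] at hB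
    rw [← hJ, ← Matrix.mulVec_mulVec, hJy, ← Matrix.mulVec_mulVec, ← Matrix.star_vecMul, hB,
      star_zero, Matrix.mulVec_zero]
  have hflat : QLin.flat G.A *ᵥ y = star z • y := by
    rw [QLin.flat, ← Matrix.mulVec_mulVec, hJy, ← Matrix.mulVec_mulVec, ← Matrix.star_vecMul, hA,
      star_smul, Matrix.mulVec_smul]
  have hAy : G.A *ᵥ y = -star z • y := by
    rw [G.flat_A_mulVec, hCy, Matrix.mulVec_zero, sub_zero, neg_eq_iff_eq_neg] at hflat
    rw [hflat, neg_smul]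
  rw [← star_eq_zero, ← hJy, hG.eq_zero_of_C_mulVec_eq_zero hAy hCy, Matrix.mulVec_zero]

end StateSpace

section Transfer

variable {m n : ℕ} {G : System m n} {s : ℂ} {v : Doubled m → ℂ}

/-- The amplitude `(s - A)⁻¹ C^♭ S v` of the modes driven by an input proportional to `v exp(st)`,
up to the sign of the coupling. -/
def response (G : System m n) (s : ℂ) (v : Doubled m → ℂ) : Doubled n → ℂ :=
  resolvent G.A s *ᵥ (QLin.flat G.C *ᵥ (G.S *ᵥ v))

lemma transfer_eq (G : System m n) (s : ℂ) :
    G.transfer s = (1 - G.C * resolvent G.A s * QLin.flat G.C) * G.S := by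
  rw [transfer, resolvent_eq_inv]

lemma transfer_mulVec (G : System m n) (s : ℂ) (v : Doubled m → ℂ) :
    G.transfer s *ᵥ v = G.S *ᵥ v - G.C *ᵥ G.response s v := by
  simp only [transfer_eq, response, Matrix.sub_mul, Matrix.sub_mulVec, Matrix.mulVec_mulVec,
    Matrix.one_mul, Matrix.mul_assoc]

lemma smul_response_sub (hs : s ∉ spectrum ℂ G.A) (v : Doubled m → ℂ) :
    s • G.response s v - G.A *ᵥ G.response s v = QLin.flat G.C *ᵥ (G.S *ᵥ v) := by
  have h := congrArg (· *ᵥ (QLin.flat G.C *ᵥ (G.S *ᵥ v))) (smul_one_sub_mul_resolvent hs)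
  simpa only [response, ← Matrix.mulVec_mulVec, Matrix.sub_mulVec, Matrix.smul_mulVec,
    Matrix.one_mulVec] using h

lemma jForm_S_mulVec_self (G : System m n) (v : Doubled m → ℂ) :
    jForm (G.S *ᵥ v) (G.S *ᵥ v) = jForm v v := by
  rw [jForm_mulVec_left, Matrix.mulVec_mulVec, G.symplectic_S.2.1, Matrix.one_mulVec]

lemma jForm_transfer_mulVec_self (hs : s ∉ spectrum ℂ G.A) (v : Doubled m → ℂ) :
    jForm (G.transfer s *ᵥ v) (G.transfer s *ᵥ v) =
      jForm v v - (s + star s) * jForm (G.response s v) (G.response s v) := by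
  set x := G.response s v
  set u := G.S *ᵥ v with hu
  have hx : s • x - G.A *ᵥ x = QLin.flat G.C *ᵥ u := smul_response_sub hs v
  have hCu : jForm (G.C *ᵥ x) u = s * jForm x x - jForm x (G.A *ᵥ x) := by
    rw [jForm_mulVec_left, ← hx, map_sub, map_smul, smul_eq_mul]
  have huC : jForm u (G.C *ᵥ x) = star s * jForm x x - jForm (G.A *ᵥ x) x := by
    rw [← star_jForm, hCu, star_sub, star_mul', star_jForm, star_jForm]
  have hCC : jForm (G.C *ᵥ x) (G.C *ᵥ x) = -jForm x (G.A *ᵥ x) - jForm (G.A *ᵥ x) x := by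
    rw [jForm_mulVec_left G.A, G.flat_A_mulVec, map_sub, map_neg, jForm_mulVec_left G.C]
    ring
  rw [transfer_mulVec, ← G.jForm_S_mulVec_self v, ← hu]
  simp only [map_sub, LinearMap.sub_apply]
  rw [huC, hCu, hCC]
  ring

lemma powerSpectrum_apply (G : System m n) (V : Matrix (Doubled m) (Doubled m) ℂ) (ω : ℝ) :
    G.powerSpectrum V ω = G.freqTransfer ω * V * (G.freqTransfer ω)ᴴ := by
  simp [powerSpectrum, spectralDensity, freqTransfer]

lemma powerSpectrum_vecMulVec (G : System m n) (v : Doubled m → ℂ) (ω : ℝ) :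
    G.powerSpectrum (Matrix.vecMulVec v (star v)) ω =
      Matrix.vecMulVec (G.freqTransfer ω *ᵥ v) (star (G.freqTransfer ω *ᵥ v)) := by
  rw [powerSpectrum_apply, Matrix.mul_vecMulVec, Matrix.vecMulVec_mul, Matrix.star_mulVec]

lemma conjMat_transfer (G : System m n) (s : ℂ) :
    conjMat (G.transfer s) = G.transfer (star s) := by
  simp only [transfer, conjMat_mul, map_sub, map_smulₛₗ, conjMat_one, conjMat_inv, conjMat_flat,
    isDoubledUp_iff.1 G.doubledUp_C, isDoubledUp_iff.1 G.isDoubledUp_A,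
    isDoubledUp_iff.1 G.symplectic_S.1, starRingEnd_apply]

open Filter Topology Bornology

lemma diffContOnCl_transfer_mulVec (hG : G.IsHurwitz) (v : Doubled m → ℂ) :
    DiffContOnCl ℂ (fun s => G.transfer s *ᵥ v) {z | 0 < z.re} := by
  have hd (s : ℂ) (hs : 0 ≤ s.re) : DifferentiableAt ℂ (fun s => G.transfer s *ᵥ v) s := by
    simp only [transfer_mulVec]
    exact (differentiableAt_const _).sub <|
      G.C.mulVecLin.toContinuousLinearMap.differentiableAt.comp s
        (differentiableAt_resolvent_mulVec (IsHurwitzMatrix.notMem_spectrum hG hs) _)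
  refine DifferentiableOn.diffContOnCl fun s hs => ?_
  rw [Complex.closure_setOfPred_lt_re] at hs
  exact (hd s hs).differentiableWithinAt

lemma tendsto_transfer (G : System m n) : Tendsto G.transfer (cobounded ℂ) (𝓝 G.S) := by
  have h := (tendsto_const_nhds (x := (1 : Matrix (Doubled m) (Doubled m) ℂ))).sub
    (tendsto_mul_resolvent_mul G.A G.C (QLin.flat G.C))
  have hc : Continuous fun X : Matrix (Doubled m) (Doubled m) ℂ => X * G.S :=
    continuous_id.matrix_mul continuous_const
  simpa only [Function.comp_def, ← transfer_eq, sub_zero, Matrix.one_mul] using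
    (hc.tendsto _).comp h

lemma tendsto_transfer_mulVec (G : System m n) (v : Doubled m → ℂ) :
    Tendsto (fun s => G.transfer s *ᵥ v) (cobounded ℂ) (𝓝 (G.S *ᵥ v)) :=
  ((continuous_id.matrix_mulVec continuous_const).tendsto _).comp G.tendsto_transfer

lemma tendsto_powerSpectrum (G : System m n) (V : Matrix (Doubled m) (Doubled m) ℂ) :
    Tendsto (G.powerSpectrum V) atTop (𝓝 (G.S * V * G.Sᴴ)) := by
  have hc : Continuous fun X : Matrix (Doubled m) (Doubled m) ℂ => X * V * Xᴴ :=
    (continuous_id.matrix_mul continuous_const).matrix_mul continuous_id.matrix_conjTranspose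
  exact ((hc.tendsto _).comp (G.tendsto_transfer.comp tendsto_neg_I_mul_atTop)).congr
    fun ω => (powerSpectrum_apply G V ω).symm

end Transfer

section Compression

variable {m n d : ℕ} {P : Matrix (Doubled n) (Doubled d) ℂ} {s : ℂ}

/-- The system obtained from `G` by restricting its coupling and hamiltonian to the modes in the
range of `P`. -/
def compress (G : System m n) (hP : IsDoubledUp P) : System m d where
  S := G.S
  C := G.C * P
  Ω := Pᴴ * G.Ω * P
  symplectic_S := G.symplectic_S
  doubledUp_C := G.doubledUp_C.mul hP
  doubledUp_Ω := by
    rw [isDoubledUp_iff, conjMat_mul, conjMat_mul, conjMat_conjTranspose, isDoubledUp_iff.1 hP,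
      isDoubledUp_iff.1 G.doubledUp_Ω]
  hermitian_Ω := Matrix.isHermitian_conjTranspose_mul_mul P G.hermitian_Ω

lemma J_mul_compress_Ω (G : System m n) (hP : IsDoubledUp P) :
    J d * (G.compress hP).Ω = QLin.flat P * (J n * G.Ω) * P := by
  simp only [compress, QLin.flat, Matrix.mul_assoc, J_mul_cancel]

lemma A_compress (G : System m n) (hP : IsDoubledUp P) :
    (G.compress hP).A = QLin.flat P * G.A * P := by
  rw [A, A, J_mul_compress_Ω, compress]
  simp only [flat_mul, Matrix.mul_sub, Matrix.sub_mul, Matrix.mul_neg,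
    Matrix.neg_mul, Matrix.mul_smul, Matrix.smul_mul, Matrix.mul_assoc]

lemma IsHurwitz.compress {G : System m n} (hG : G.IsHurwitz) {hP : IsDoubledUp P}
    (hPP : QLin.flat P * P = 1) (hinv : G.A * P = P * (G.compress hP).A) :
    (G.compress hP).IsHurwitz :=
  IsHurwitzMatrix.of_mul_eq_mul hG hPP hinv

lemma transfer_compress {G : System m n} (hG : G.IsHurwitz) {hP : IsDoubledUp P}
    (hPP : QLin.flat P * P = 1) (hinv : G.A * P = P * (G.compress hP).A) (hs : 0 ≤ s.re) :
    (G.compress hP).transfer s =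
      (1 - G.C * resolvent G.A s * (P * QLin.flat P) * QLin.flat G.C) * G.S := by
  have hR : resolvent G.A s * P = P * resolvent (G.compress hP).A s :=
    resolvent_mul_of_mul_eq_mul hinv (IsHurwitzMatrix.notMem_spectrum hG hs)
      (IsHurwitzMatrix.notMem_spectrum (hG.compress hPP hinv) hs)
  have hC : (G.compress hP).C = G.C * P := rfl
  have hS : (G.compress hP).S = G.S := rfl
  rw [transfer_eq, hC, hS, Matrix.mul_assoc G.C P, ← hR, flat_mul]
  simp only [Matrix.mul_assoc]

end Compression

section ZeroRemoval

variable {m n : ℕ} {G : System m n} {v : Doubled m → ℂ} {z : ℂ}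

lemma flat_A_mulVec_response (hz : z ∉ spectrum ℂ G.A) (h0 : G.transfer z *ᵥ v = 0) :
    QLin.flat G.A *ᵥ G.response z v = -z • G.response z v := by
  rw [transfer_mulVec, sub_eq_zero] at h0
  rw [flat_A_mulVec, ← h0, ← smul_response_sub hz]
  module

lemma add_star_mul_jForm_response_self (hv : jForm v v = 1) (hz : z ∉ spectrum ℂ G.A)
    (h0 : G.transfer z *ᵥ v = 0) :
    (z + star z) * jForm (G.response z v) (G.response z v) = 1 := by
  have h := jForm_transfer_mulVec_self hz v
  rw [h0, map_zero, hv] at h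
  exact (sub_eq_zero.1 h.symm).symm

lemma C_mulVec_resolvent_mulVec_response (hz : z ∉ spectrum ℂ G.A)
    (h0 : G.transfer z *ᵥ v = 0) {s : ℂ} (hs : s ∉ spectrum ℂ G.A) (hsz : s ≠ z) :
    G.C *ᵥ (resolvent G.A s *ᵥ G.response z v) = (s - z)⁻¹ • (G.transfer s *ᵥ v) := by
  have hres : G.response z v =
      (s - z) • (resolvent G.A s *ᵥ G.response z v) + G.response s v := by
    have h := congrArg (· *ᵥ G.response z v) (resolvent_mul_smul_one_sub hs)
    simp only [← Matrix.mulVec_mulVec, Matrix.sub_mulVec, Matrix.smul_mulVec,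
      Matrix.one_mulVec] at h
    change _ = _ + resolvent G.A s *ᵥ (QLin.flat G.C *ᵥ (G.S *ᵥ v))
    rw [← smul_response_sub hz v, ← Matrix.mulVec_smul, ← Matrix.mulVec_add, sub_smul,
      sub_add_sub_cancel, h]
  have hC : G.S *ᵥ v = (s - z) • (G.C *ᵥ (resolvent G.A s *ᵥ G.response z v)) +
      G.C *ᵥ G.response s v := by
    rw [transfer_mulVec, sub_eq_zero] at h0
    rw [h0, ← Matrix.mulVec_smul, ← Matrix.mulVec_add, ← hres]
  rw [eq_inv_smul_iff₀ (sub_ne_zero.2 hsz), transfer_mulVec, eq_sub_iff_add_eq, ← hC]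

lemma doubledCols_mul_flat_mulVec_response (hv : jForm v v = 1) (hz : z ∉ spectrum ℂ G.A)
    (h0 : G.transfer z *ᵥ v = 0) {c : ℂ}
    (hc : jForm (c • G.response z v) (c • G.response z v) = 1) :
    (doubledCols (fun _ : Fin 1 => c • G.response z v) *
        QLin.flat (doubledCols fun _ : Fin 1 => c • G.response z v)) *ᵥ
      (QLin.flat G.C *ᵥ (G.S *ᵥ v)) = (z + star z) • G.response z v := by
  set x := G.response z v
  have hCx : G.C *ᵥ x = G.S *ᵥ v := by
    rw [transfer_mulVec, sub_eq_zero] at h0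
    exact h0.symm
  have hb : jForm x (QLin.flat G.C *ᵥ (G.S *ᵥ v)) = 1 := by
    rw [← jForm_mulVec_left, hCx, jForm_S_mulVec_self, hv]
  have hconj : jForm (conjVec (QLin.flat G.C *ᵥ (G.S *ᵥ v))) x = 0 := by
    rw [conjVec_mulVec, isDoubledUp_iff.1 G.doubledUp_C.flat, ← jForm_mulVec_right, hCx,
      ← star_jForm, jForm_conjVec_self, star_zero]
  have hcc : star c * c = z + star z := by
    simp only [map_smulₛₗ, LinearMap.smul_apply, RingHom.id_apply, smul_eq_mul] at hc
    rw [starRingEnd_apply] at hc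
    have hx := add_star_mul_jForm_response_self hv hz h0
    refine mul_right_cancel₀ (right_ne_zero_of_mul_eq_one hx) ?_
    rw [hx, ← hc]
    ring
  rw [doubledCols_mul_flat_mulVec, Fin.sum_univ_one]
  simp only [map_smulₛₗ, LinearMap.smul_apply, RingHom.id_apply, hb, hconj, smul_eq_mul, mul_zero,
    mul_one, smul_smul]
  rw [starRingEnd_apply, hcc, zero_mul, zero_smul, add_zero]

theorem IsHurwitz.exists_lt_of_transfer_mulVec_eq_zero (hG : G.IsHurwitz) (hv : jForm v v = 1)
    (hz : 0 < z.re) (h0 : G.transfer z *ᵥ v = 0) :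
    ∃ (d : ℕ) (K : System m d), d < n ∧ K.IsHurwitz ∧ ∀ s : ℂ, 0 ≤ s.re → s ≠ z →
      K.transfer s *ᵥ v = ((s + star z) / (s - z)) • (G.transfer s *ᵥ v) := by
  have hzA := IsHurwitzMatrix.notMem_spectrum hG hz.le
  set x := G.response z v
  set b := QLin.flat G.C *ᵥ (G.S *ᵥ v) with hb
  have hpos : 0 < (jForm x x).re := by
    have h := add_star_mul_jForm_response_self hv hzA h0
    rw [← starRingEnd_apply, Complex.add_conj, ← ofReal_re_jForm_self, ← Complex.ofReal_mul,
      Complex.ofReal_eq_one] at h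
    exact (mul_pos_iff_of_pos_left (by positivity)).1 (h ▸ one_pos)
  obtain ⟨c, hc⟩ := exists_jForm_smul_self_eq_one hpos
  obtain ⟨d, P, hdn, hP, hPP, hPw, hPW⟩ := exists_isometry_add_eq_one hc
  have hinv : G.A * P = P * (G.compress hP).A := by
    rw [A_compress]
    refine mul_eq_of_flat_mulVec_eigenvector G.isDoubledUp_A (z := -z) ?_ hP hPw hPW
    rw [Matrix.mulVec_smul, flat_A_mulVec_response hzA h0, smul_comm]
  have hproj : (P * QLin.flat P) *ᵥ b = b - (z + star z) • x := by
    rw [eq_sub_of_add_eq hPW, Matrix.sub_mulVec, Matrix.one_mulVec,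
      doubledCols_mul_flat_mulVec_response hv hzA h0 hc]
  refine ⟨d, G.compress hP, hdn, hG.compress hPP hinv, fun s hs hsz => ?_⟩
  have hCR := C_mulVec_resolvent_mulVec_response hzA h0
    (IsHurwitzMatrix.notMem_spectrum hG hs) hsz
  calc (G.compress hP).transfer s *ᵥ v
      = G.S *ᵥ v - G.C *ᵥ (resolvent G.A s *ᵥ ((P * QLin.flat P) *ᵥ b)) := by
        rw [transfer_compress hG hPP hinv hs, hb]
        simp only [Matrix.sub_mul, Matrix.sub_mulVec, Matrix.mulVec_mulVec, Matrix.one_mul,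
          Matrix.mul_assoc]
    _ = G.transfer s *ᵥ v + (z + star z) • (s - z)⁻¹ • (G.transfer s *ᵥ v) := by
        rw [hproj, ← hCR, transfer_mulVec, response, ← hb]
        simp only [Matrix.mulVec_sub, Matrix.mulVec_smul]
        abel
    _ = ((s + star z) / (s - z)) • (G.transfer s *ᵥ v) := by
        have hne : s - z ≠ 0 := sub_ne_zero.2 hsz
        have hfactor : (s + star z) / (s - z) = 1 + (z + star z) * (s - z)⁻¹ := by
          field_simp
          ring
        rw [hfactor, smul_smul, add_smul, one_smul]

lemma mul_star_eq_one_of_re_eq_zero {s : ℂ} (hs : s.re = 0) (hz : 0 < z.re) :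
    ((s + star z) / (s - z)) * star ((s + star z) / (s - z)) = 1 := by
  have hstar : star s = -s := by
    apply Complex.ext <;> simp [hs]
  have hne : s - z ≠ 0 := fun h => hz.ne' (by rw [← sub_eq_zero.1 h, hs])
  have hne' : -s - star z ≠ 0 := by
    rw [← hstar, ← star_sub]
    exact star_ne_zero.2 hne
  rw [star_div₀, star_add, star_sub, star_star, hstar, div_mul_div_comm, div_eq_one_iff_eq
    (mul_ne_zero hne hne')]
  ring

theorem IsGloballyMinimal.transfer_mulVec_ne_zero (hv : jForm v v = 1)
    (hG : G.IsGloballyMinimal (Matrix.vecMulVec v (star v))) (hz : 0 ≤ z.re) :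
    G.transfer z *ᵥ v ≠ 0 := by
  intro h0
  rcases hz.eq_or_lt with hz | hz
  · have h := add_star_mul_jForm_response_self hv
      (IsHurwitzMatrix.notMem_spectrum hG.1 hz.le) h0
    have hstar : z + star z = 0 := by
      apply Complex.ext <;> simp [← hz]
    rw [hstar, zero_mul] at h
    exact zero_ne_one h
  · obtain ⟨d, K, hdn, hK, hKs⟩ := hG.1.exists_lt_of_transfer_mulVec_eq_zero hv hz h0
    refine (hG.2 d K hK (funext fun ω => ?_)).not_gt hdn
    have hre : (-(Complex.I * ω)).re = 0 := by simp
    have hKω : K.freqTransfer ω *ᵥ v = _ := hKs _ hre.ge fun h => hz.ne' (h ▸ hre)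
    rw [powerSpectrum_vecMulVec, powerSpectrum_vecMulVec, hKω, star_smul, Matrix.smul_vecMulVec,
      Matrix.vecMulVec_smul, smul_smul, mul_star_eq_one_of_re_eq_zero hre hz, one_smul]
    rfl

end ZeroRemoval

section Uniqueness

variable {m n k : ℕ} {G : System m n} {K : System m k} {v : Doubled m → ℂ}

theorem transfer_mulVec_eq_of_powerSpectrum_eq (hv : jForm v v = 1) (hS : G.S = K.S)
    (hG : G.IsGloballyMinimal (Matrix.vecMulVec v (star v)))
    (hK : K.IsGloballyMinimal (Matrix.vecMulVec v (star v)))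
    (h : G.powerSpectrum (Matrix.vecMulVec v (star v)) =
      K.powerSpectrum (Matrix.vecMulVec v (star v))) {s : ℂ} (hs : 0 ≤ s.re) :
    G.transfer s *ᵥ v = K.transfer s *ᵥ v := by
  have hSv : G.S *ᵥ v ≠ 0 := fun h0 => by
    simpa [h0, hv] using G.jForm_S_mulVec_self v
  refine eq_of_vecMulVec_star_eq (w₁ := fun s => G.transfer s *ᵥ v)
    (w₂ := fun s => K.transfer s *ᵥ v) hSv (diffContOnCl_transfer_mulVec hG.1 v)
    (diffContOnCl_transfer_mulVec hK.1 v) (G.tendsto_transfer_mulVec v)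
    (hS ▸ K.tendsto_transfer_mulVec v) (fun _ => hG.transfer_mulVec_ne_zero hv)
    (fun _ => hK.transfer_mulVec_ne_zero hv) (fun y => ?_) hs
  have hω := congrFun h (-y)
  have hy : -(Complex.I * ((-y : ℝ) : ℂ)) = y * Complex.I := by
    push_cast
    ring
  rwa [powerSpectrum_vecMulVec, powerSpectrum_vecMulVec, freqTransfer, freqTransfer, hy] at hω

end Uniqueness

section Equivalence

variable {m n k : ℕ} {G : System m n} {K : System m k} {P : Matrix (Doubled n) (Doubled k) ℂ}
  {V : Matrix (Doubled m) (Doubled m) ℂ} {Ψ : ℝ → Matrix (Doubled m) (Doubled m) ℂ}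

lemma mul_eq_mul_A_compress (G : System m n) (hP : IsSymplectic P) :
    G.A * P = P * (G.compress hP.1).A := by
  rw [A_compress, ← Matrix.mul_assoc, ← Matrix.mul_assoc, hP.2.2, Matrix.one_mul]

lemma freqTransfer_compress (hG : G.IsHurwitz) (hP : IsSymplectic P) :
    (G.compress hP.1).freqTransfer = G.freqTransfer := by
  funext ω
  rw [freqTransfer, freqTransfer, transfer_eq G, transfer_compress hG hP.2.1
    (G.mul_eq_mul_A_compress hP) (by simp), hP.2.2, Matrix.mul_one]

lemma IsGloballyMinimalRealisation.compress (hG : G.IsGloballyMinimalRealisation V Ψ)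
    (hP : IsSymplectic P) : (G.compress hP.1).IsGloballyMinimalRealisation V Ψ := by
  obtain ⟨hS, hΨ, hH, hmin⟩ := hG
  have hspec : (G.compress hP.1).powerSpectrum V = G.powerSpectrum V := by
    funext ω
    rw [powerSpectrum_apply, powerSpectrum_apply, freqTransfer_compress hH hP]
  exact ⟨hS, hspec.trans hΨ, hH.compress hP.2.1 (G.mul_eq_mul_A_compress hP), fun j L hL hLΨ =>
    (le_of_mul_eq_one_of_doubled hP.2.1).trans (hmin j L hL (hLΨ.trans hspec))⟩

lemma symplecticEquiv_compress (G : System m n) (hP : IsSymplectic P) :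
    G.SymplecticEquiv (G.compress hP.1) :=
  ⟨rfl, QLin.flat P, hP.flat, by rw [flat_flat, J_mul_compress_Ω], by rw [flat_flat]; rfl⟩

lemma SymplecticEquiv.exists_eq_compress (h : G.SymplecticEquiv K) :
    ∃ (P : Matrix (Doubled n) (Doubled k) ℂ) (hP : IsSymplectic P), K = G.compress hP.1 := by
  obtain ⟨hS, T, hT, hΩ, hC⟩ := h
  have hC' : K.C = (G.compress hT.flat.1).C := hC
  refine ⟨QLin.flat T, hT.flat, eq_of_A_eq hS.symm hC' ?_⟩
  rw [A, A, J_mul_compress_Ω, ← hC', hΩ, flat_flat]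

lemma IsGloballyMinimalRealisation.of_symplecticEquiv (hG : G.IsGloballyMinimalRealisation V Ψ)
    (h : G.SymplecticEquiv K) : K.IsGloballyMinimalRealisation V Ψ := by
  obtain ⟨P, hP, rfl⟩ := h.exists_eq_compress
  exact hG.compress hP

end Equivalence

section ClassicalRealisation

variable {m n k : ℕ} {G : System m n} {K : System m k}
  {A₀ : Matrix (Doubled k) (Doubled k) ℂ} {B₀ : Matrix (Doubled k) (Doubled m) ℂ}
  {C₀ : Matrix (Doubled m) (Doubled k) ℂ}

lemma isMinimalClassicalRealisation (hS : G.S = 1) (hG : G.IsHurwitz) :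
    IsMinimalClassicalRealisation G.A (-QLin.flat G.C) G.C G.freqTransfer where
  doubledUp_A := G.isDoubledUp_A
  doubledUp_B := by
    rw [isDoubledUp_iff, map_neg, isDoubledUp_iff.1 G.doubledUp_C.flat]
  doubledUp_C := G.doubledUp_C
  observable := hG.isObservable
  controllable := hG.isControllable
  transfer_eq ω _ := by
    rw [freqTransfer, transfer, hS, Matrix.mul_one, Matrix.mul_neg, sub_eq_add_neg]

theorem symplecticEquiv_of_freqTransfer_eq (hGS : G.S = 1) (hG : G.IsHurwitz) (hKS : K.S = 1)
    (hK : K.IsHurwitz) (h : G.freqTransfer = K.freqTransfer) : G.SymplecticEquiv K := by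
  obtain ⟨T, T', hT, -, hTT', hTA, hTC⟩ := (isMinimalClassicalRealisation hKS hK).exists_similarity
    (h ▸ isMinimalClassicalRealisation hGS hG)
  have hlyap := eq_of_lyapunov_eq hK (G.lyapunov_of_mul_eq_mul hTA hTC) K.lyapunov
  have hTT : QLin.flat T * T = 1 := by
    rw [QLin.flat, Matrix.mul_assoc, Matrix.mul_assoc, ← Matrix.mul_assoc Tᴴ, hlyap, J_mul_J]
  have hTs : IsSymplectic T := isSymplectic_of_flat_mul_self hT hTT hTT'
  have hKA : K.A = (G.compress hTs.1).A := by
    rw [A_compress, Matrix.mul_assoc, ← hTA, ← Matrix.mul_assoc, hTT, Matrix.one_mul]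
  rw [eq_of_A_eq (hKS.trans hGS.symm) hTC.symm hKA]
  exact G.symplecticEquiv_compress hTs

theorem exists_isPhysicalTransformation (hS : G.S = 1) (hG : G.IsHurwitz)
    (h : IsMinimalClassicalRealisation A₀ B₀ C₀ G.freqTransfer) :
    ∃ T, IsPhysicalTransformation A₀ C₀ T := by
  obtain ⟨R, R', hR, hR'R, hRR', hRA, hRC⟩ :=
    h.exists_similarity (isMinimalClassicalRealisation hS hG)
  obtain rfl : k = n :=
    (le_of_mul_eq_one_of_doubled hR'R).antisymm (le_of_mul_eq_one_of_doubled hRR')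
  exact ⟨R, hR, .of_mul_eq_one R' hRR', G.lyapunov_of_mul_eq_mul hRA hRC⟩

theorem exists_compress_of_isPhysicalTransformation (hS : G.S = 1) (hG : G.IsHurwitz)
    (h : IsMinimalClassicalRealisation A₀ B₀ C₀ G.freqTransfer)
    {T : Matrix (Doubled k) (Doubled k) ℂ} (hT : IsPhysicalTransformation A₀ C₀ T) :
    ∃ (P : Matrix (Doubled n) (Doubled k) ℂ) (hP : IsSymplectic P),
      (G.compress hP.1).C = C₀ * T⁻¹ ∧ (G.compress hP.1).A = T * A₀ * T⁻¹ := by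
  obtain ⟨hTd, hTu, hTl⟩ := hT
  obtain ⟨R, R', hR, hR'R, hRR', hRA, hRC⟩ :=
    h.exists_similarity (isMinimalClassicalRealisation hS hG)
  have hA₀ : IsHurwitzMatrix A₀ := IsHurwitzMatrix.of_mul_eq_mul hG hR'R hRA.symm
  have hJ : Tᴴ * J k * T = Rᴴ * J n * R :=
    eq_of_lyapunov_eq hA₀ hTl (G.lyapunov_of_mul_eq_mul hRA hRC)
  have hflat : QLin.flat R * R = QLin.flat T * T := by
    simpa only [QLin.flat, Matrix.mul_assoc] using congrArg (J k * ·) hJ.symm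
  have hTT : T * T⁻¹ = 1 := Matrix.mul_nonsing_inv _ ((Matrix.isUnit_iff_isUnit_det T).1 hTu)
  have hTT' : T⁻¹ * T = 1 := mul_eq_one_comm.1 hTT
  have hPP : QLin.flat (R * T⁻¹) * (R * T⁻¹) = 1 := calc
    _ = QLin.flat T⁻¹ * (QLin.flat R * R) * T⁻¹ := by simp only [flat_mul, Matrix.mul_assoc]
    _ = QLin.flat (T * T⁻¹) * (T * T⁻¹) := by rw [hflat, flat_mul]; simp only [Matrix.mul_assoc]
    _ = 1 := by rw [hTT, flat_one, Matrix.one_mul]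
  have hP : IsSymplectic (R * T⁻¹) :=
    isSymplectic_of_flat_mul_self (T' := T * R') (hR.mul hTd.inv) hPP <| by
      rw [Matrix.mul_assoc, ← Matrix.mul_assoc _ T, hTT', Matrix.one_mul, hRR']
  refine ⟨R * T⁻¹, hP, hRC ▸ (Matrix.mul_assoc _ _ _).symm, ?_⟩
  calc (G.compress hP.1).A = QLin.flat (R * T⁻¹) * (G.A * R) * T⁻¹ := by
        rw [A_compress]; simp only [Matrix.mul_assoc]
    _ = QLin.flat (R * T⁻¹) * (R * (T⁻¹ * T)) * A₀ * T⁻¹ := by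
        rw [hTT', Matrix.mul_one, ← hRA]; simp only [Matrix.mul_assoc]
    _ = T * A₀ * T⁻¹ := by
        rw [← Matrix.mul_assoc R, ← Matrix.mul_assoc, hPP, Matrix.one_mul]

theorem IsGloballyMinimalRealisation.exists_of_isPhysicalTransformation
    {V : Matrix (Doubled m) (Doubled m) ℂ} {Ψ : ℝ → Matrix (Doubled m) (Doubled m) ℂ}
    (hG : G.IsGloballyMinimalRealisation V Ψ)
    (h : IsMinimalClassicalRealisation A₀ B₀ C₀ G.freqTransfer)
    {T : Matrix (Doubled k) (Doubled k) ℂ} (hT : IsPhysicalTransformation A₀ C₀ T) :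
    ∃ K : System m k, K.C = C₀ * T⁻¹ ∧
      K.Ω = Complex.I • (J k * (T * A₀ * T⁻¹ +
        (1 / 2 : ℂ) • (QLin.flat (C₀ * T⁻¹) * (C₀ * T⁻¹)))) ∧
      K.freqTransfer = G.freqTransfer ∧ K.IsGloballyMinimalRealisation V Ψ := by
  obtain ⟨P, hP, hC, hA⟩ := exists_compress_of_isPhysicalTransformation hG.1 hG.2.2.1 h hT
  refine ⟨G.compress hP.1, hC, ?_, freqTransfer_compress hG.2.2.1 hP, hG.compress hP⟩
  rw [← J_mul_cancel (G.compress hP.1).Ω, J_mul_Ω, hA, hC, Matrix.mul_smul]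

end ClassicalRealisation

section GlobalMinimality

variable {m n k : ℕ} {G : System m n} {K : System m k} {V : Matrix (Doubled m) (Doubled m) ℂ}

/-- The system `(1, C, Ω)` obtained from `(S, C, Ω)` by removing the scattering matrix. -/
def unscattered (G : System m n) : System m n :=
  { G with S := 1, symplectic_S := isSymplectic_one }

lemma powerSpectrum_unscattered (h : G.S * V * G.Sᴴ = V) :
    G.unscattered.powerSpectrum V = G.powerSpectrum V := by
  funext ω
  have hfactor : G.freqTransfer ω = G.unscattered.freqTransfer ω * G.S := by
    change _ = _ * 1 * G.S
    rw [Matrix.mul_one]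
    rfl
  rw [powerSpectrum_apply, powerSpectrum_apply, hfactor, Matrix.conjTranspose_mul]
  conv_lhs => rw [← h]
  simp only [Matrix.mul_assoc]

lemma S_mul_mul_of_powerSpectrum_eq (hS : G.S = 1)
    (h : K.powerSpectrum V = G.powerSpectrum V) : K.S * V * K.Sᴴ = V := by
  simpa [hS] using tendsto_nhds_unique (h ▸ K.tendsto_powerSpectrum V) (G.tendsto_powerSpectrum V)

theorem exists_isGloballyMinimalRealisation (hS : G.S = 1) (hG : G.IsHurwitz) :
    ∃ (k : ℕ) (K : System m k), K.IsGloballyMinimalRealisation V (G.powerSpectrum V) := by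
  classical
  have hex : ∃ k, ∃ K : System m k, K.IsHurwitz ∧ K.powerSpectrum V = G.powerSpectrum V :=
    ⟨n, G, hG, rfl⟩
  obtain ⟨K, hK, hKG⟩ := Nat.find_spec hex
  have hK₁ : K.unscattered.powerSpectrum V = G.powerSpectrum V :=
    (powerSpectrum_unscattered (S_mul_mul_of_powerSpectrum_eq hS hKG)).trans hKG
  exact ⟨_, K.unscattered, rfl, hK₁, hK, fun j L hL hLK =>
    Nat.find_min' hex ⟨L, hL, hLK.trans hK₁⟩⟩

theorem IsGloballyMinimalRealisation.freqTransfer_eq {G : System 1 n} {K : System 1 k}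
    {v : Doubled 1 → ℂ} (hv : jForm v v = 1) {Ψ : ℝ → Matrix (Doubled 1) (Doubled 1) ℂ}
    (hG : G.IsGloballyMinimalRealisation (Matrix.vecMulVec v (star v)) Ψ)
    (hK : K.IsGloballyMinimalRealisation (Matrix.vecMulVec v (star v)) Ψ) :
    G.freqTransfer = K.freqTransfer := by
  have heq (s : ℂ) (hs : 0 ≤ s.re) : G.transfer s *ᵥ v = K.transfer s *ᵥ v :=
    transfer_mulVec_eq_of_powerSpectrum_eq hv (hG.1.trans hK.1.symm) hG.2.2 hK.2.2
      (hG.2.1.trans hK.2.1.symm) hs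
  funext ω
  set s : ℂ := -(Complex.I * ω) with hs
  refine eq_of_mulVec_eq_of_mulVec_conjVec_eq hv (heq s (by simp [hs])) ?_
  have hconj {j : ℕ} (L : System 1 j) :
      L.transfer s *ᵥ conjVec v = conjVec (L.transfer (star s) *ᵥ v) := by
    rw [conjVec_mulVec, conjMat_transfer, star_star]
  exact (hconj G).trans ((heq (star s) (by simp [hs])).symm ▸ (hconj K).symm)

open Classical in
/-- The transfer function recovered from a power spectrum `Ψ` for input covariance `V`: that of a
globally minimal realisation of `Ψ`, or `0` if there is none. -/
def minimalTransfer (V : Matrix (Doubled m) (Doubled m) ℂ)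
    (Ψ : ℝ → Matrix (Doubled m) (Doubled m) ℂ) : ℝ → Matrix (Doubled m) (Doubled m) ℂ :=
  if h : ∃ (k : ℕ) (K : System m k), K.IsGloballyMinimalRealisation V Ψ then
    h.choose_spec.choose.freqTransfer
  else 0

lemma exists_freqTransfer_eq_minimalTransfer (hS : G.S = 1) (hG : G.IsHurwitz) :
    ∃ (k : ℕ) (K : System m k), K.IsGloballyMinimalRealisation V (G.powerSpectrum V) ∧
      K.freqTransfer = minimalTransfer V (G.powerSpectrum V) := by
  have h := exists_isGloballyMinimalRealisation (V := V) hS hG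
  exact ⟨_, _, h.choose_spec.choose_spec, by rw [minimalTransfer, dif_pos h]⟩

end GlobalMinimality

end System

end QLin

end

theorem mainTheorem5
    (N M : Matrix (Fin 1) (Fin 1) ℂ) (hV : QLin.IsPureInput N M) :
    ∃ factor : (ℝ → Matrix (QLin.Doubled 1) (QLin.Doubled 1) ℂ) →
        (ℝ → Matrix (QLin.Doubled 1) (QLin.Doubled 1) ℂ),
      ∀ (n : ℕ) (G : QLin.System 1 n), G.S = 1 → G.IsHurwitz →
        ∀ Ψ Ξ' : ℝ → Matrix (QLin.Doubled 1) (QLin.Doubled 1) ℂ,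
          Ψ = G.powerSpectrum (QLin.inputCovariance N M) → Ξ' = factor Ψ →
          -- `Ξ'` is the transfer function of a globally minimal realisation
          (∃ (n' : ℕ) (G' : QLin.System 1 n'),
            G'.IsGloballyMinimalRealisation (QLin.inputCovariance N M) Ψ ∧
              G'.freqTransfer = Ξ') ∧
          -- `Ξ'` has a minimal doubled-up classical realisation
          (∃ (k : ℕ) (A₀ : Matrix (QLin.Doubled k) (QLin.Doubled k) ℂ)
            (B₀ : Matrix (QLin.Doubled k) (QLin.Doubled 1) ℂ)
            (C₀ : Matrix (QLin.Doubled 1) (QLin.Doubled k) ℂ),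
            QLin.IsMinimalClassicalRealisation A₀ B₀ C₀ Ξ') ∧
          -- a globally minimal realisation is obtained from any such realisation of `Ξ'`
          (∀ (k : ℕ) (A₀ : Matrix (QLin.Doubled k) (QLin.Doubled k) ℂ)
            (B₀ : Matrix (QLin.Doubled k) (QLin.Doubled 1) ℂ)
            (C₀ : Matrix (QLin.Doubled 1) (QLin.Doubled k) ℂ),
            QLin.IsMinimalClassicalRealisation A₀ B₀ C₀ Ξ' →
              (∃ T, QLin.IsPhysicalTransformation A₀ C₀ T) ∧
              ∀ T, QLin.IsPhysicalTransformation A₀ C₀ T →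
                ∃ G' : QLin.System 1 k,
                  G'.C = C₀ * T⁻¹ ∧
                  G'.Ω = Complex.I • (QLin.J k *
                    (T * A₀ * T⁻¹ + (1 / 2 : ℂ) • (QLin.flat (C₀ * T⁻¹) * (C₀ * T⁻¹)))) ∧
                  G'.freqTransfer = Ξ' ∧
                  G'.IsGloballyMinimalRealisation (QLin.inputCovariance N M) Ψ) ∧
          -- uniqueness up to symplectic equivalence
          (∀ (k : ℕ) (G₁ : QLin.System 1 k),
            G₁.IsGloballyMinimalRealisation (QLin.inputCovariance N M) Ψ →
              G₁.freqTransfer = Ξ' ∧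
              ∀ (l : ℕ) (G₂ : QLin.System 1 l),
                G₂.IsGloballyMinimalRealisation (QLin.inputCovariance N M) Ψ ↔
                  G₁.SymplecticEquiv G₂) := by
  obtain ⟨v, hv, hVv⟩ := QLin.exists_vecMulVec_of_isPureInput hV
  rw [hVv]
  refine ⟨QLin.System.minimalTransfer (Matrix.vecMulVec v (star v)), ?_⟩
  rintro n G hS hG _ _ rfl rfl
  obtain ⟨_, K, hK, hKΞ⟩ := QLin.System.exists_freqTransfer_eq_minimalTransfer hS hG
  rw [← hKΞ]
  refine ⟨⟨_, K, hK, rfl⟩,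
    ⟨_, _, _, _, QLin.System.isMinimalClassicalRealisation hK.1 hK.2.2.1⟩,
    fun k A₀ B₀ C₀ h => ⟨QLin.System.exists_isPhysicalTransformation hK.1 hK.2.2.1 h,
      fun T hT => hK.exists_of_isPhysicalTransformation h hT⟩,
    fun k G₁ hG₁ => ⟨hG₁.freqTransfer_eq hv hK, fun l G₂ => ⟨fun hG₂ => ?_,
      hG₁.of_symplecticEquiv⟩⟩⟩
  exact QLin.System.symplecticEquiv_of_freqTransfer_eq hG₁.1 hG₁.2.2.1 hG₂.1 hG₂.2.2.1
    (hG₁.freqTransfer_eq hv hG₂)
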